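/- **Setting.** A \emph{forest} is a finite disjoint union of finite in-trees, i.e. a finite digraph in which every vertex has at most one outgoing arc and leads to a root (a vertex without outgoing arc); equality of forests means isomorphism. The depth of a vertex is its distance to its root, and the depth of a forest is the largest depth of its vertices ($0$ for the empty forest). The sum of forests is the disjoint union, so a forest is a finite multiset of trees. The product $\mathbf{A}\mathbf{B}$ has as vertices the pairs $(v,w)$ of vertices of equal depth, with arcs $(v,w)\to(v',w')$ whenever $v\to v'$ and $w\to w'$; $\mathbf{A}^k$ is the $k$-fold product for $k\ge 1$, and $\mathbf{A}^0$ is the simple oriented path with the depth of $\mathbf{A}$. $\mathcal{D}(\mathbf{F})$ is the multiset of trees rooted in the predecessors of the roots of $\mathbf{F}$, and $\mathcal{R}(\mathbf{F})$ is the tree with $\mathcal{D}(\mathcal{R}(\mathbf{F}))=\mathbf{F}$. Trees are totally ordered by comparing lexicographically their codes: the code of a tree is the list of the in-degrees of its vertices in the order of a breadth-first search, where the children of each vertex are sorted, recursively, by the same order. **Division of trees.** $\mathtt{divide}(\mathbf{a},\mathbf{b})$ works on $\mathbf{A}=\mathcal{D}(\mathbf{a})$, $\mathbf{B}=\mathcal{D}(\mathbf{b})$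 and starts with $\mathbf{C}=\varnothing$. It repeats: let $\mathbf{F}=\mathbf{A}\setminus\mathbf{B}\mathbf{C}$; if $\mathbf{F}=\varnothing$, return $\mathcal{R}(\mathbf{C})$; otherwise let $\mathbf{t}_s$ be the smallest tree of maximal depth in $\mathbf{F}$ and $\mathbf{t}_b$ the smallest tree of $\mathbf{B}$ of depth at least that of $\mathbf{t}_s$ (return $\bot$ if there is none), and let $\mathbf{x}=\mathtt{divide}(\mathbf{t}_s,\mathbf{t}_b)$; if $\mathbf{x}=\bot$ or $\mathbf{B}(\mathbf{C}+\mathbf{x})\not\subseteq\mathbf{A}$, return $\bot$; otherwise add $\mathbf{x}$ to $\mathbf{C}$. **Root of forests.** For an integer $k\ge1$, $\mathtt{root}(\mathbf{A},k)$ returns $\mathbf{A}$ if $\mathbf{A}$ is a single path. Otherwise it starts with $\mathbf{R}=\varnothing$, $\mathbf{t}_m=\varnothing$ and repeats: let $\mathbf{F}=\mathbf{A}\setminus\mathbf{R}^k$; if $\mathbf{F}=\varnothing$, return $\mathbf{R}$; otherwise let $\mathbf{t}_s$ be the smallest tree of maximal depth in $\mathbf{F}$. If $\mathbf{t}_m=\varnothing$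 or $\mathbf{t}_m^k>\mathbf{t}_s$, let $\mathbf{t}_i=\mathcal{R}(\mathtt{root}(\mathcal{D}(\mathbf{t}_s),k))$ and set $\mathbf{t}_m=\mathbf{t}_i$; else let $\mathbf{t}_i=\mathtt{divide}(\mathbf{t}_s,\mathbf{t}_m^{k-1})$. If $\mathbf{t}_i=\bot$ (in particular if the recursive call returned $\bot$) or $(\mathbf{R}+\mathbf{t}_i)^k\not\subseteq\mathbf{A}$, return $\bot$; otherwise add $\mathbf{t}_i$ to $\mathbf{R}$. **Theorem.** Let $\mathbf{A}$ be a forest and $k$ a strictly positive integer. Then $\mathtt{root}(\mathbf{A},k)$ terminates, and computes the $k$-th root of $\mathbf{A}$: if it returns a forest $\mathbf{X}$, then $\mathbf{X}^k=\mathbf{A}$; and if $\mathbf{X}$ is a forest with $\mathbf{X}^k=\mathbf{A}$, then it returns $\mathbf{X}$ (up to isomorphism). In particular it returns $\bot$ exactly when $\mathbf{A}$ has no $k$-th root. This holds for every representation of $\mathbf{A}$ as a list of trees in which each vertex comes with the list, in any order, of its predecessors. -/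

import Mathlib

/-! ### Forests as graphs -/

/-- `HasDepth E n v`: following the arcs `E v u` from `v` one reaches, after exactly `n` steps,
a vertex without outgoing arc, i.e. the distance from `v` to its root is `n`. -/
def HasDepth {V : Type} (E : V → V → Prop) : ℕ → V → Prop
  | 0, v => ∀ u, ¬ E v u
  | n + 1, v => ∃ u, E v u ∧ HasDepth E n u

/-- A finite forest of finite in-trees: a finite digraph, arcs `E v u` pointing from a vertex `v`
to its parent `u`, in which every vertex has at most one outgoing arc and every vertex leads to a
root (a vertex without outgoing arc). -/
structure FinForest where
  V : Type
  E : V → V → Prop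
  finite : Finite V
  unique : ∀ v u u', E v u → E v u' → u = u'
  rooted : ∀ v, ∃ n, HasDepth E n v

namespace FinForest

/-- Equality of forests is isomorphism of digraphs. -/
def Iso (A B : FinForest) : Prop := Nonempty (A.E ≃r B.E)

/-- The product of forests: the vertices are the pairs of vertices of equal depth, and the arcs are
those of the direct product. -/
def prod (A B : FinForest) : FinForest where
  V := {p : A.V × B.V // ∃ n, HasDepth A.E n p.1 ∧ HasDepth B.E n p.2}
  E p q := A.E p.1.1 q.1.1 ∧ B.E p.1.2 q.1.2
  finite := by
    have := A.finite
    have := B.finite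
    infer_instance
  unique := by
    rintro p q q' ⟨h1, h2⟩ ⟨h1', h2'⟩
    exact Subtype.ext (Prod.ext (A.unique _ _ _ h1 h1') (B.unique _ _ _ h2 h2'))
  rooted := by
    rintro ⟨⟨v, w⟩, n, hv, hw⟩
    refine ⟨n, ?_⟩
    induction n generalizing v w with
    | zero => exact fun q h => hv _ h.1
    | succ n ih =>
      obtain ⟨v', hv', hv2⟩ := hv
      obtain ⟨w', hw', hw2⟩ := hw
      exact ⟨⟨(v', w'), n, hv2, hw2⟩, ⟨hv', hw'⟩, ih v' w' hv2 hw2⟩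

/-- The simple oriented path of length `d` (with `d + 1` vertices). -/
def path (d : ℕ) : FinForest where
  V := Fin (d + 1)
  E i j := i.val = j.val + 1
  finite := inferInstance
  unique := by
    intro v u u' h h'
    exact Fin.ext (by omega)
  rooted := by
    rintro ⟨n, hn⟩
    refine ⟨n, ?_⟩
    induction n with
    | zero => exact fun u h => by simp at h
    | succ n ih => exact ⟨⟨n, by omega⟩, rfl, ih (by omega)⟩

/-- The depth of a forest: the largest depth of a vertex (`0` for the empty forest). -/
noncomputable def depth (A : FinForest) : ℕ := sSup {n | ∃ v, HasDepth A.E n v}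

/-- The powers of a forest; by convention the power with exponent `0` is a path as long as the
forest is deep, so that it is neutral for the product with the forest. -/
noncomputable def pow (A : FinForest) : ℕ → FinForest
  | 0 => path A.depth
  | n + 1 => (pow A n).prod A

end FinForest

/-! ### Trees as data -/

/-- Finite trees as data structures: a root with the list of the trees rooted in its
predecessors. Forests as data are lists of such trees. -/
inductive OTree : Type
  | node : List OTree → OTree

mutual

/-- Equality of trees as data is decidable. -/
def OTree.decEq : (s t : OTree) → Decidable (s = t)
  | .node as, .node bs =>
    match OTree.decEqList as bs with
    | isTrue h => isTrue (congrArg OTree.node h)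
    | isFalse h => isFalse fun h' => h (OTree.node.inj h')

/-- Equality of lists of trees as data is decidable. -/
def OTree.decEqList : (as bs : List OTree) → Decidable (as = bs)
  | [], [] => isTrue rfl
  | [], _ :: _ => isFalse (by simp)
  | _ :: _, [] => isFalse (by simp)
  | a :: as, b :: bs =>
    match OTree.decEq a b, OTree.decEqList as bs with
    | isTrue h, isTrue h' => isTrue (by rw [h, h'])
    | isFalse h, _ => isFalse fun h' => h (List.cons.inj h').1
    | _, isFalse h => isFalse fun h' => h (List.cons.inj h').2

end

instance : DecidableEq OTree := OTree.decEq

/-- `Encodes A v t`: the data `t` is the tree of `A` rooted in the vertex `v`, the predecessors of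
each vertex being listed, without repetition, in some order. -/
inductive Encodes (A : FinForest) : A.V → OTree → Prop
  | node (v : A.V) (ws : List A.V) (ts : List OTree) :
      ws.Nodup → (∀ w, w ∈ ws ↔ A.E w v) → List.Forall₂ (Encodes A) ws ts →
      Encodes A v (OTree.node ts)

/-- The list of trees `F` is a representation of the forest `A`. -/
def Represents (F : List OTree) (A : FinForest) : Prop :=
  ∃ rs : List A.V, rs.Nodup ∧ (∀ r, r ∈ rs ↔ ∀ u, ¬ A.E r u) ∧ List.Forall₂ (Encodes A) rs F

namespace OTree

/-- The trees rooted in the predecessors of the root. -/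
def children : OTree → List OTree
  | node cs => cs

/-- The length of the longest branch. -/
def depth : OTree → ℕ
  | node cs => (cs.map fun c => depth c + 1).foldr max 0

/-- The in-degrees of the vertices at depth `n`, from left to right. -/
def levelDegrees : ℕ → OTree → List ℕ
  | 0, t => [t.children.length]
  | n + 1, t => t.children.flatMap (levelDegrees n)

/-- The in-degrees of all the vertices in the order of a breadth-first search. -/
def code (t : OTree) : List ℕ :=
  (List.range (t.depth + 1)).flatMap fun n => levelDegrees n t

/-- The normal form of a tree: children are sorted, recursively, by their codes (compared
lexicographically). Isomorphic trees have the same normal form. The total order on trees is the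
lexicographic order of the codes of normal forms. -/
def normalize : OTree → OTree
  | node cs => node ((cs.map fun c => normalize c).mergeSort fun s t => decide (s.code ≤ t.code))

/-- The product of trees, level by level, before normalization. -/
def rawMul : OTree → OTree → OTree
  | node as, t => node (as.flatMap fun a => t.children.map fun b => rawMul a b)

/-- The product of trees. -/
def mul (s t : OTree) : OTree := (rawMul s t).normalize

/-- The path of length `d`. -/
def path : ℕ → OTree
  | 0 => node []
  | d + 1 => node [path d]

/-- The powers of a tree, with the convention that the power with exponent `0` is a path. -/
def pow (t : OTree) : ℕ → OTree
  | 0 => path t.depth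
  | n + 1 => (pow t n).mul t

end OTree

namespace ForestData

/-- The depth of a forest (`0` for the empty one). -/
def depth (F : List OTree) : ℕ := (F.map OTree.depth).foldr max 0

/-- The product of forests. -/
def mul (A B : List OTree) : List OTree := A.flatMap fun a => B.map fun b => a.mul b

/-- The powers of a forest, with the convention that the power with exponent `0` is a path. -/
def pow (F : List OTree) : ℕ → List OTree
  | 0 => [OTree.path (depth F)]
  | n + 1 => mul (pow F n) F

/-- The smallest of the trees of depth at least `d` in a forest. -/
def minDeep (d : ℕ) (F : List OTree) : Option OTree :=
  (F.filter fun t => decide (d ≤ t.depth)).argmin OTree.code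

theorem mem_of_minDeep {d : ℕ} {F : List OTree} {t : OTree} (h : minDeep d F = some t) :
    t ∈ F :=
  List.mem_of_mem_filter (List.argmin_mem h)

theorem length_mul (A B : List OTree) : (mul A B).length = A.length * B.length := by
  induction A with
  | nil => simp [mul]
  | cons a A ih =>
    simp only [mul, List.flatMap_cons, List.length_append, List.length_map,
      List.length_cons] at ih ⊢
    rw [ih]; ring

theorem length_pow (F : List OTree) (k : ℕ) : (pow F k).length = F.length ^ k := by
  induction k with
  | zero => simp [pow]
  | succ k ih => rw [pow, length_mul, ih, _root_.pow_succ]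

theorem sizeOf_children_lt {t : OTree} {F : List OTree} (h : t ∈ F) :
    sizeOf t.children < sizeOf F := by
  have := List.sizeOf_lt_of_mem h
  cases t
  simp only [OTree.children, OTree.node.sizeOf_spec] at this ⊢
  omega

/-- The loop of the division of forests: given the forests `A` and `B` and the part `C` of the
quotient that has been found so far, take a smallest tree `ts` among the deepest trees of the
remaining forest `A \ B * C`, divide it by the smallest tree of `B` that is at least as deep,
and add the result to `C`. The answer `none` stands for `⊥`. -/
def divideLoop (A B C : List OTree) : Option (List OTree) :=
  let F := A.diff (mul B C)
  match hs : minDeep (depth F) F with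
  | none => some C
  | some ts =>
    match hb : minDeep ts.depth B with
    | none => none
    | some tb =>
      match divideLoop ts.children tb.children [] with
      | none => none
      | some q =>
        let x := (OTree.node q).normalize
        if hle : List.Subperm (mul B (x :: C)) A then divideLoop A B (x :: C) else none
termination_by (sizeOf A, A.length - C.length)
decreasing_by
  · exact Prod.Lex.left _ _ (sizeOf_children_lt ((A.diff_subset _) (mem_of_minDeep hs)))
  · apply Prod.Lex.right
    have h1 := hle.length_le
    rw [length_mul, List.length_cons] at h1
    have h2 := List.length_pos_of_mem (mem_of_minDeep hb)
    have h3 : C.length + 1 ≤ A.length := le_trans (Nat.le_mul_of_pos_left _ h2) h1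
    simp only [List.length_cons]
    omega

/-- The division of trees: a tree `x`, of depth at most that of `a`, with `a = b * x`. -/
def divide (a b : OTree) : Option OTree :=
  (divideLoop a.children b.children []).map fun q => (OTree.node q).normalize

mutual

/-- The procedure `root` on forests of trees in normal form; `none` stands for `⊥`. -/
def root (k : ℕ) (hk : 0 < k) (A : List OTree) : Option (List OTree) :=
  if A = [OTree.path (depth A)] then some A else rootLoop k hk A [] none
termination_by (sizeOf A, A.length + 1)
decreasing_by
  apply Prod.Lex.right
  simp

/-- The loop of `root`, with the current values of the variables `R` and `tm` (`none` for the
empty tree). -/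
def rootLoop (k : ℕ) (hk : 0 < k) (A R : List OTree) (tm : Option OTree) :
    Option (List OTree) :=
  let F := A.diff (pow R k)
  match hs : minDeep (depth F) F with
  | none => some R
  | some ts =>
    if tm.all fun m => decide (ts.code < (m.pow k).code) then
      match root k hk ts.children with
      | none => none
      | some r =>
        let ti := (OTree.node r).normalize
        if hle : List.Subperm (pow (ti :: R) k) A then rootLoop k hk A (ti :: R) (some ti)
        else none
    else
      match tm.bind fun m => divide ts (m.pow (k - 1)) with
      | none => none
      | some ti =>
        if hle : List.Subperm (pow (ti :: R) k) A then rootLoop k hk A (ti :: R) tm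
        else none
termination_by (sizeOf A, A.length - R.length)
decreasing_by
  · exact Prod.Lex.left _ _ (sizeOf_children_lt ((A.diff_subset _) (mem_of_minDeep hs)))
  · apply Prod.Lex.right
    have h1 := hle.length_le
    rw [length_pow, List.length_cons] at h1
    have h2 := Nat.le_self_pow hk.ne' (R.length + 1)
    simp only [List.length_cons]
    omega
  · apply Prod.Lex.right
    have h1 := hle.length_le
    rw [length_pow, List.length_cons] at h1
    have h2 := Nat.le_self_pow hk.ne' (R.length + 1)
    simp only [List.length_cons]
    omega

end

/-- The procedure `root` on arbitrary data: the trees are first put in normal form. -/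
def kthRoot (k : ℕ) (hk : 0 < k) (F : List OTree) : Option (List OTree) :=
  root k hk (F.map OTree.normalize)

end ForestData

/-!
The isomorphism class of a tree is given by its normal form (`NTree`), so a forest is a finite
multiset of such classes, and the theorem becomes a statement about multisets: `fpow X n` is the
power of `X` with exponent `n + 1`, and the procedure has to recover `X` from it.

The algorithms are greedy, and they are correct because the order of trees is compatible with the
product: `a ≤ b` implies `a * c ≤ b * c`, strictly so if `a < b` and `c` is at least as deep as
both `a` and `b`. To see this, trees are compared depth by depth. Two trees that agree up to
depth `n` are compared at the next depth by the lexicographic order of the sorted lists of their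
children, truncated at depth `n`; this amounts to saying that, outside a common part, some child
of the smaller tree is smaller than all the children of the other one
(`NTree.card_lt_or_mlt_of_cut`, `NTree.cut_lt_of_card_lt_or_mlt`). Such a configuration survives
the multiplication by the children of `c` of depth at least `n`, by induction; the children of `c`
of depth less than `n` give the same products on both sides, as these products only depend on
truncations at a smaller depth (`NTree.cut_mul_lt_cut_mul`). In particular the powers of a tree
determine it (`NTree.tpow_succ_injective`).

Hence, if `A = B * X` and the part `C` of `X` is already known, the smallest of the deepest trees
of `A \ B * C` is the product of the smallest of the deepest trees of the rest of `X` and of the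
smallest tree of `B` that is at least as deep; so each round of the division finds one more
tree of `X` (`ForestData.exists_divideLoop_eq_some`). Likewise, if `A = X ^ k` and the part `R` of
`X` is known, let `y` be the smallest of the deepest trees of the rest of `X`, and `m` the smallest
of `y` and the trees of `R`. The smallest of the deepest trees of `A \ R ^ k` is
`m ^ (k - 1) * y` (`NTree.exists_fpow_add_eq`). It is smaller than the `k`-th power of the smallest
tree of `R` exactly if `y` is smaller than that tree, and then it is `y ^ k`, so that `y` is found
by a recursive call; otherwise `y` is found by a division (`ForestData.exists_rootLoop_eq_some`).
Conversely, the last test of the loop ensures that every answer is a root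
(`ForestData.toM_eq_of_root_eq_some`).

The link with graphs is `FinForest.trees`, the multiset of the classes of the trees of a forest.
It characterizes the representations of the forest by data, is a complete invariant for
isomorphism, takes every value, and turns powers of forests into powers of multisets.
-/

/-! ### The order of the codes, level by level -/

namespace List

theorem forall₂_flatMap_eq {α β γ : Type*} {f : α → List γ} {g : β → List γ} {l : List α}
    {l' : List β} (hlen : Forall₂ (fun a b => (f a).length = (g b).length) l l')
    (h : l.flatMap f = l'.flatMap g) : Forall₂ (fun a b => f a = g b) l l' := by
  induction hlen with
  | nil => exact .nil
  | cons hab _ ih =>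
    rw [flatMap_cons, flatMap_cons] at h
    obtain ⟨h1, h2⟩ := append_inj h hab
    exact .cons h1 (ih h2)

theorem append_lt_append_of_length_eq {α : Type*} [LT α] {a b u v : List α}
    (hl : a.length = b.length) (h : a < b) : a ++ u < b ++ v := by
  induction h with
  | nil => simp at hl
  | rel hr => exact List.Lex.rel hr
  | cons _ ih => exact List.Lex.cons (ih (by simpa using hl))

/-- Two concatenations of blocks of pairwise equal lengths are compared by the first pair of
distinct blocks. -/
theorem exists_of_flatMap_lt {α β γ : Type*} [LinearOrder γ] {f : α → List γ} {g : β → List γ}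
    {r : α → β → Prop} (hr : ∀ a b, r a b → (f a).length = (g b).length) {l : List α}
    {l' : List β} (hl : Forall₂ r l l') (h : l.flatMap f < l'.flatMap g) :
    ∃ p x u q y v, l = p ++ x :: u ∧ l' = q ++ y :: v ∧
      Forall₂ (fun a b => r a b ∧ f a = g b) p q ∧ r x y ∧ f x < g y := by
  induction hl with
  | nil => simp at h
  | @cons a b l l' hab _ ih =>
    rw [flatMap_cons, flatMap_cons] at h
    rcases lt_trichotomy (f a) (g b) with hlt | heq | hgt
    · exact ⟨[], a, l, [], b, l', rfl, rfl, .nil, hab, hlt⟩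
    · rw [heq] at h
      have h' : l.flatMap f < l'.flatMap g := by
        by_contra hn
        rcases (not_lt.mp hn).lt_or_eq with h1 | h1
        · exact lt_asymm h (append_left_lt h1)
        · rw [h1] at h; exact lt_irrefl _ h
      obtain ⟨p, x, u, q, y, v, h1, h2, h3, h4⟩ := ih h'
      exact ⟨a :: p, x, u, b :: q, y, v, by rw [h1]; rfl, by rw [h2]; rfl,
        .cons ⟨hab, heq⟩ h3, h4⟩
    · exact absurd h (lt_asymm (append_lt_append_of_length_eq (hr _ _ hab).symm hgt))

end List

namespace OTree

theorem induction {P : OTree → Prop} (h : ∀ cs, (∀ c ∈ cs, P c) → P (node cs)) (t : OTree) :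
    P t := by
  match t with
  | node cs => exact h cs fun c _ => induction h c
termination_by t

@[simp] theorem children_node (cs : List OTree) : (node cs).children = cs := rfl

@[simp] theorem node_children (t : OTree) : node t.children = t := by cases t; rfl

theorem length_levelDegrees_succ (n : ℕ) (t : OTree) :
    (levelDegrees (n + 1) t).length = (levelDegrees n t).sum := by
  induction n generalizing t with
  | zero => simp [levelDegrees, List.length_flatMap]
  | succ n ih =>
    have hsum (l : List OTree) : (l.flatMap (levelDegrees n)).sum =
        (l.map fun c => (levelDegrees n c).sum).sum := by
      induction l with
      | nil => rfl
      | cons c l ih => simp [ih]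
    rw [levelDegrees, levelDegrees, List.length_flatMap, hsum]
    simp only [ih]

/-- The two trees have the same in-degrees at the depths smaller than `n`. -/
def SameLevels (n : ℕ) (s t : OTree) : Prop := ∀ i < n, levelDegrees i s = levelDegrees i t

/-- The in-degrees of the two trees differ for the first time at depth `n`, and there the first
tree is smaller. -/
def LevelLT (n : ℕ) (s t : OTree) : Prop :=
  SameLevels n s t ∧ levelDegrees n s < levelDegrees n t

theorem SameLevels.length_eq {n : ℕ} {s t : OTree} (h : SameLevels n s t) :
    (levelDegrees n s).length = (levelDegrees n t).length := by
  cases n with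
  | zero => simp [levelDegrees]
  | succ n => rw [length_levelDegrees_succ, length_levelDegrees_succ, h n (by omega)]

theorem SameLevels.mono {m n : ℕ} {s t : OTree} (h : SameLevels n s t) (hm : m ≤ n) :
    SameLevels m s t := fun i hi => h i (by omega)

theorem SameLevels.forall₂_children {n : ℕ} {s t : OTree} (h : SameLevels (n + 1) s t) :
    List.Forall₂ (SameLevels n) s.children t.children := by
  induction n with
  | zero =>
    have h0 : s.children.length = t.children.length := by simpa [levelDegrees] using h 0 (by omega)
    rw [List.forall₂_iff_get]
    exact ⟨h0, fun _ _ _ i hi => by omega⟩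
  | succ n ih =>
    have h1 := ih (h.mono (by omega))
    have h2 := List.forall₂_flatMap_eq (h1.imp fun _ _ hab => hab.length_eq) (h (n + 1) (by omega))
    rw [List.forall₂_iff_get] at h1 h2 ⊢
    refine ⟨h1.1, fun i hi hi' j hj => ?_⟩
    rcases Nat.lt_succ_iff_lt_or_eq.mp hj with hj | rfl
    · exact h1.2 i hi hi' j hj
    · exact h2.2 i hi hi'

theorem depth_node (cs : List OTree) :
    (node cs).depth = (cs.map fun c => depth c + 1).foldr max 0 := by
  rw [depth]

theorem depth_le_iff {t : OTree} {n : ℕ} : t.depth ≤ n ↔ ∀ c ∈ t.children, c.depth + 1 ≤ n := by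
  cases t with
  | node cs =>
    rw [depth_node, children_node]
    induction cs with
    | nil => simp
    | cons c cs ih => simp [ih]

theorem levelDegrees_eq_nil_iff {n : ℕ} {t : OTree} : levelDegrees n t = [] ↔ t.depth < n := by
  induction n generalizing t with
  | zero => simp [levelDegrees]
  | succ n ih =>
    rw [levelDegrees, List.flatMap_eq_nil_iff, Nat.lt_succ_iff, depth_le_iff]
    exact forall₂_congr fun c _ => ih

theorem code_eq_of_depth_le {t : OTree} {n : ℕ} (h : t.depth ≤ n) :
    t.code = (List.range (n + 1)).flatMap fun i => levelDegrees i t := by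
  induction n, h using Nat.le_induction with
  | base => rfl
  | succ n hn ih =>
    rw [ih, List.range_succ (n := n + 1), List.flatMap_append]
    simp [levelDegrees_eq_nil_iff.mpr (show t.depth < n + 1 by omega)]

/-- As the in-degrees at one depth determine the number of vertices at the next one, the codes are
compared by the first depth at which the in-degrees differ. -/
theorem LevelLT.code_lt {n : ℕ} {s t : OTree} (h : LevelLT n s t) : s.code < t.code := by
  have hr : ∀ r : OTree, ∀ N, r.depth ≤ n + N → r.code =
      ((List.range n).flatMap fun i => levelDegrees i r) ++ (levelDegrees n r ++
        (List.range N).flatMap fun i => levelDegrees (n + (1 + i)) r) := by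
    intro r N hN
    rw [code_eq_of_depth_le hN, show n + N + 1 = n + (1 + N) by omega, List.range_add,
      List.range_add, List.flatMap_append, List.map_append, List.flatMap_append]
    simp [List.flatMap_map, Function.comp_def]
  rw [hr s (s.depth + t.depth) (by omega), hr t (s.depth + t.depth) (by omega)]
  have : ((List.range n).flatMap fun i => levelDegrees i s) =
      (List.range n).flatMap fun i => levelDegrees i t :=
    List.flatMap_congr fun i hi => h.1 i (List.mem_range.mp hi)
  rw [this]
  exact List.append_left_lt (List.append_lt_append_of_length_eq h.1.length_eq h.2)

theorem eq_of_sameLevels {s t : OTree} (h : ∀ n, SameLevels n s t) : s = t := by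
  induction s using induction generalizing t with
  | h cs ih =>
    cases t with
    | node ds =>
      congr 1
      have h1 := fun n => (h (n + 1)).forall₂_children
      simp only [List.forall₂_iff_get, children_node] at h1
      refine List.ext_get (h1 0).1 fun i hi hi' => ?_
      exact ih _ (List.get_mem _ _) fun n => (h1 n).2 i hi hi'

theorem exists_levelLT {s t : OTree} (h : s ≠ t) : ∃ n, LevelLT n s t ∨ LevelLT n t s := by
  have h1 : ∃ n, levelDegrees n s ≠ levelDegrees n t := by
    by_contra! h1
    exact h (eq_of_sameLevels fun n i _ => h1 i)
  classical
  have h2 := Nat.find_spec h1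
  have h3 : SameLevels (Nat.find h1) s t := fun i hi => not_not.mp (Nat.find_min h1 hi)
  rcases lt_or_gt_of_ne h2 with h4 | h4
  · exact ⟨_, .inl ⟨h3, h4⟩⟩
  · exact ⟨_, .inr ⟨fun i hi => (h3 i hi).symm, h4⟩⟩

theorem code_lt_iff {s t : OTree} : s.code < t.code ↔ ∃ n, LevelLT n s t := by
  refine ⟨fun h => ?_, fun ⟨n, h⟩ => h.code_lt⟩
  obtain ⟨n, h1 | h1⟩ := exists_levelLT (s := s) (t := t) (by rintro rfl; exact lt_irrefl _ h)
  · exact ⟨n, h1⟩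
  · exact absurd h (lt_asymm h1.code_lt)

theorem code_injective : Function.Injective code := by
  intro s t h
  by_contra hne
  obtain ⟨n, h1 | h1⟩ := exists_levelLT hne
  · exact h1.code_lt.ne h
  · exact h1.code_lt.ne h.symm

/-! ### Truncation -/

/-- The tree of the vertices of depth at most `n`. -/
def cut : ℕ → OTree → OTree
  | 0, _ => node []
  | n + 1, t => node (t.children.map (cut n))

theorem levelDegrees_cut_of_lt {i n : ℕ} (h : i < n) (t : OTree) :
    levelDegrees i (cut n t) = levelDegrees i t := by
  induction i generalizing n t with
  | zero => cases n with
    | zero => omega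
    | succ n => simp [levelDegrees, cut]
  | succ i ih => cases n with
    | zero => omega
    | succ n =>
      simp only [levelDegrees, cut, children_node, List.flatMap_map]
      exact List.flatMap_congr fun c _ => ih (by omega) c

theorem eq_zero_of_mem_levelDegrees_cut {i n x : ℕ} {t : OTree} (h : n ≤ i)
    (hx : x ∈ levelDegrees i (cut n t)) : x = 0 := by
  induction n generalizing i t with
  | zero => cases i with
    | zero => simpa [levelDegrees, cut] using hx
    | succ i => simp [levelDegrees, cut] at hx
  | succ n ih => cases i with
    | zero => omega
    | succ i =>
      simp only [levelDegrees, cut, children_node, List.flatMap_map, List.mem_flatMap] at hx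
      obtain ⟨c, _, hc⟩ := hx
      exact ih (by omega) hc

theorem depth_cut_le (n : ℕ) (t : OTree) : (cut n t).depth ≤ n := by
  induction n generalizing t with
  | zero => simp [cut, depth]
  | succ n ih =>
    rw [depth_le_iff]
    simp only [cut, children_node, List.mem_map]
    rintro _ ⟨c, _, rfl⟩
    have := ih c
    omega

theorem cut_eq_iff {n : ℕ} {s t : OTree} : cut n s = cut n t ↔ SameLevels n s t := by
  refine ⟨fun h i hi => by rw [← levelDegrees_cut_of_lt hi, h, levelDegrees_cut_of_lt hi], ?_⟩
  intro h
  induction n generalizing s t with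
  | zero => rfl
  | succ n ih =>
    have h1 := h.forall₂_children
    simp only [cut, node.injEq]
    rw [← List.forall₂_eq_eq_eq, List.forall₂_map_left_iff, List.forall₂_map_right_iff]
    exact h1.imp fun a b hab => ih hab

theorem cut_cut {m n : ℕ} (h : m ≤ n) (t : OTree) : cut m (cut n t) = cut m t :=
  cut_eq_iff.mpr fun _ hi => levelDegrees_cut_of_lt (by omega) t

theorem LevelLT.cut {m n : ℕ} {s t : OTree} (h : LevelLT m s t) (hm : m < n) :
    LevelLT m (cut n s) (cut n t) := by
  refine ⟨fun i hi => ?_, ?_⟩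
  · rw [levelDegrees_cut_of_lt (by omega), levelDegrees_cut_of_lt (by omega), h.1 i hi]
  · rw [levelDegrees_cut_of_lt hm, levelDegrees_cut_of_lt hm]; exact h.2

theorem code_cut_mono {s t : OTree} (n : ℕ) (h : s.code ≤ t.code) :
    (cut n s).code ≤ (cut n t).code := by
  rcases h.lt_or_eq with h | h
  · obtain ⟨m, hm⟩ := code_lt_iff.mp h
    rcases lt_or_ge m n with h1 | h1
    · exact (hm.cut h1).code_lt.le
    · rw [cut_eq_iff.mpr (hm.1.mono h1)]
  · rw [code_injective h]

/-- Truncation at depth `n + 1` keeps the in-degrees up to depth `n`, so that this is where the two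
truncated trees differ. -/
theorem LevelLT.of_cut {n : ℕ} {s t : OTree} (heq : OTree.cut n s = OTree.cut n t)
    (hlt : (OTree.cut (n + 1) s).code < (OTree.cut (n + 1) t).code) : LevelLT n s t := by
  have h1 := cut_eq_iff.mp heq
  refine ⟨h1, ?_⟩
  obtain ⟨m, hm⟩ := code_lt_iff.mp hlt
  have h2 : ¬ m < n := fun h => by
    have := hm.2
    rw [levelDegrees_cut_of_lt (by omega), levelDegrees_cut_of_lt (by omega), h1 m h] at this
    exact lt_irrefl _ this
  have h3 : ¬ n < m := fun h => by
    have := hm.2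
    have e : ∀ r, levelDegrees m (OTree.cut (n + 1) r) =
        List.replicate (levelDegrees m (OTree.cut (n + 1) r)).length 0 := fun r =>
      List.eq_replicate_of_mem fun x hx => eq_zero_of_mem_levelDegrees_cut h hx
    rw [e s, e t, hm.1.length_eq] at this
    exact lt_irrefl _ this
  obtain rfl : m = n := by omega
  have := hm.2
  rwa [levelDegrees_cut_of_lt (by omega), levelDegrees_cut_of_lt (by omega)] at this

/-- At a positive depth, the comparison of two trees is that of the lists of their children. -/
theorem LevelLT.exists_children {n : ℕ} {s t : OTree} (h : LevelLT (n + 1) s t) :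
    ∃ p x u q y v, s.children = p ++ x :: u ∧ t.children = q ++ y :: v ∧
      p.map (OTree.cut (n + 1)) = q.map (OTree.cut (n + 1)) ∧ LevelLT n x y := by
  obtain ⟨p, x, u, q, y, v, hs, ht, hpq, hxy⟩ :=
    List.exists_of_flatMap_lt (fun _ _ hab => hab.length_eq) h.1.forall₂_children h.2
  refine ⟨p, x, u, q, y, v, hs, ht, ?_, hxy⟩
  rw [← List.forall₂_eq_eq_eq, List.forall₂_map_left_iff, List.forall₂_map_right_iff]
  refine hpq.imp fun a b hab => cut_eq_iff.mpr fun i hi => ?_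
  rcases Nat.lt_succ_iff_lt_or_eq.mp hi with hi | rfl
  · exact hab.1 i hi
  · exact hab.2

end OTree

/-! ### Isomorphism classes of trees -/

namespace OTree

/-- Sorting by codes, as in the normal form. -/
def sortByCode (l : List OTree) : List OTree := l.mergeSort fun s t => decide (s.code ≤ t.code)

theorem sortByCode_perm (l : List OTree) : (sortByCode l).Perm l := List.mergeSort_perm _ _

theorem pairwise_sortByCode (l : List OTree) :
    (sortByCode l).Pairwise fun s t => s.code ≤ t.code := by
  have := List.pairwise_mergeSort (le := fun s t : OTree => decide (s.code ≤ t.code))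
    (fun a b c => by simpa using fun h1 h2 => le_trans h1 h2)
    (fun a b => by simpa using le_total a.code b.code) l
  exact this.imp fun h => of_decide_eq_true h

theorem sortByCode_eq_self {l : List OTree} (h : l.Pairwise fun s t => s.code ≤ t.code) :
    sortByCode l = l :=
  List.mergeSort_of_pairwise (h.imp fun h => decide_eq_true h)

theorem sortByCode_eq_of_perm {l l' : List OTree} (h : l.Perm l') :
    sortByCode l = sortByCode l' := by
  refine List.Perm.eq_of_pairwise (fun a b _ _ h1 h2 => code_injective (le_antisymm h1 h2))
    (pairwise_sortByCode l) (pairwise_sortByCode l') ?_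
  exact (sortByCode_perm l).trans (h.trans (sortByCode_perm l').symm)

theorem normalize_node (cs : List OTree) :
    normalize (node cs) = node (sortByCode (cs.map normalize)) := by
  rw [normalize, sortByCode]

theorem children_normalize_perm (t : OTree) :
    (normalize t).children.Perm (t.children.map normalize) := by
  cases t with
  | node cs => rw [normalize_node]; exact sortByCode_perm _

theorem normalize_normalize (t : OTree) : normalize (normalize t) = normalize t := by
  induction t using induction with
  | h cs ih =>
    rw [normalize_node, normalize_node, List.map_congr_left (g := id), List.map_id,
      sortByCode_eq_self (pairwise_sortByCode _)]
    intro c hc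
    obtain ⟨d, hd, rfl⟩ := List.mem_map.mp ((sortByCode_perm _).mem_iff.mp hc)
    exact ih d hd

theorem depth_normalize (t : OTree) : (normalize t).depth = t.depth := by
  induction t using induction with
  | h cs ih =>
    refine eq_of_forall_ge_iff fun n => ?_
    rw [depth_le_iff, depth_le_iff]
    simp only [(children_normalize_perm _).mem_iff, List.mem_map, children_node,
      forall_exists_index, and_imp, forall_apply_eq_imp_iff₂]
    exact forall₂_congr fun c hc => by rw [ih c hc]

/-- Being in normal form. -/
def IsNormal (t : OTree) : Prop := t.normalize = t

theorem isNormal_node_iff {cs : List OTree} :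
    IsNormal (node cs) ↔ (∀ c ∈ cs, IsNormal c) ∧ cs.Pairwise fun s t => s.code ≤ t.code := by
  constructor
  · intro h
    rw [IsNormal, normalize_node, node.injEq] at h
    refine ⟨fun c hc => ?_, h ▸ pairwise_sortByCode _⟩
    rw [← h] at hc
    obtain ⟨d, _, rfl⟩ := List.mem_map.mp ((sortByCode_perm _).mem_iff.mp hc)
    exact normalize_normalize d
  · rintro ⟨h1, h2⟩
    rw [IsNormal, normalize_node, List.map_congr_left (g := id) h1, List.map_id,
      sortByCode_eq_self h2]

theorem IsNormal.of_mem_children {t c : OTree} (h : IsNormal t) (hc : c ∈ t.children) :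
    IsNormal c := by
  cases t with
  | node cs => exact (isNormal_node_iff.mp h).1 c hc

theorem IsNormal.cut {t : OTree} (h : IsNormal t) (n : ℕ) : IsNormal (cut n t) := by
  induction n generalizing t with
  | zero => exact isNormal_node_iff.mpr ⟨by simp, .nil⟩
  | succ n ih =>
    cases t with
    | node cs =>
      obtain ⟨h1, h2⟩ := isNormal_node_iff.mp h
      refine isNormal_node_iff.mpr ⟨?_, ?_⟩
      · simp only [children_node, List.mem_map]
        rintro _ ⟨c, hc, rfl⟩
        exact ih (h1 c hc)
      · exact List.pairwise_map.mpr (h2.imp fun hab => code_cut_mono n hab)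

end OTree

/-- An isomorphism class of trees, given by its representative in normal form. -/
@[ext]
structure NTree where
  val : OTree
  isNormal : val.IsNormal

namespace NTree

/-- The class of a tree. -/
def nf (t : OTree) : NTree := ⟨t.normalize, t.normalize_normalize⟩

/-- The multiset of the classes of the trees of a forest. -/
def toM (F : List OTree) : Multiset NTree := ↑(F.map nf)

/-- The multiset of the trees rooted in the predecessors of the root. -/
def children (t : NTree) : Multiset NTree := toM t.1.children

/-- The tree with a given multiset of trees rooted in the predecessors of the root. -/
noncomputable def node (S : Multiset NTree) : NTree := nf (.node (S.toList.map NTree.val))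

/-- The length of the longest branch. -/
def depth (t : NTree) : ℕ := t.1.depth

/-- The tree of the vertices of depth at most `n`. -/
def cut (n : ℕ) (t : NTree) : NTree := ⟨t.1.cut n, t.2.cut n⟩

/-- The product, level by level. -/
instance : Mul NTree := ⟨fun s t => nf (.rawMul s.1 t.1)⟩

/-- The product of forests. -/
def fmul (S T : Multiset NTree) : Multiset NTree := (S ×ˢ T).map fun p => p.1 * p.2

instance : LinearOrder NTree :=
  LinearOrder.lift' (fun t => t.1.code) fun _ _ h => NTree.ext (OTree.code_injective h)

theorem le_iff {s t : NTree} : s ≤ t ↔ s.1.code ≤ t.1.code := Iff.rfl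

theorem lt_iff {s t : NTree} : s < t ↔ s.1.code < t.1.code := Iff.rfl

@[simp] theorem nf_val (t : NTree) : nf t.1 = t := NTree.ext t.2

theorem nf_eq_iff {s t : OTree} : nf s = nf t ↔ s.normalize = t.normalize := NTree.ext_iff

theorem nf_normalize (t : OTree) : nf t.normalize = nf t := nf_eq_iff.mpr t.normalize_normalize

theorem depth_nf (t : OTree) : (nf t).depth = t.depth := t.depth_normalize

theorem toM_perm {F G : List OTree} (h : F.Perm G) : toM F = toM G :=
  Multiset.coe_eq_coe.mpr (h.map _)

@[simp] theorem toM_map_val (l : List NTree) : toM (l.map NTree.val) = l := by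
  rw [toM, List.map_map, List.map_congr_left (f := nf ∘ val) (g := id) fun t _ => nf_val t,
    List.map_id]

theorem toM_map_normalize (F : List OTree) : toM (F.map OTree.normalize) = toM F := by
  simp [toM, Function.comp_def, nf_normalize]

theorem mem_toM {F : List OTree} {t : NTree} : t ∈ toM F ↔ ∃ s ∈ F, nf s = t := by
  simp [toM]

theorem nf_node_congr {cs ds : List OTree} (h : toM cs = toM ds) :
    nf (.node cs) = nf (.node ds) := by
  rw [nf_eq_iff, OTree.normalize_node, OTree.normalize_node]
  congr 1
  apply OTree.sortByCode_eq_of_perm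
  have h1 := (Multiset.coe_eq_coe.mp h).map NTree.val
  rwa [List.map_map, List.map_map] at h1

theorem nf_node (cs : List OTree) : nf (.node cs) = node (toM cs) :=
  nf_node_congr (by rw [toM_map_val, Multiset.coe_toList])

theorem children_nf (t : OTree) : (nf t).children = toM t.children := by
  rw [children, nf, toM_perm t.children_normalize_perm, toM_map_normalize]

@[simp] theorem children_node (S : Multiset NTree) : (node S).children = S := by
  rw [node, children_nf, OTree.children_node, toM_map_val, Multiset.coe_toList]

@[simp] theorem node_children (t : NTree) : node t.children = t := by
  rw [children, ← nf_node, OTree.node_children, nf_val]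

theorem children_injective : Function.Injective children := fun s t h => by
  rw [← node_children s, h, node_children]

theorem induction {P : NTree → Prop} (h : ∀ t, (∀ c ∈ t.children, P c) → P t) (t : NTree) :
    P t := by
  suffices ∀ s : OTree, P (nf s) by simpa using this t.1
  intro s
  induction s using OTree.induction with
  | h cs ih =>
    refine h _ fun c hc => ?_
    rw [children_nf, mem_toM] at hc
    obtain ⟨s, hs, rfl⟩ := hc
    exact ih s hs

theorem depth_le_iff {t : NTree} {n : ℕ} : t.depth ≤ n ↔ ∀ c ∈ t.children, c.depth + 1 ≤ n := by
  rw [depth, OTree.depth_le_iff, children]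
  simp [mem_toM, depth_nf]

theorem depth_lt_of_mem_children {t c : NTree} (h : c ∈ t.children) : c.depth < t.depth :=
  depth_le_iff.mp le_rfl c h

theorem exists_mem_children_depth {t : NTree} (h : t.depth ≠ 0) :
    ∃ c ∈ t.children, c.depth + 1 = t.depth := by
  by_contra! hne
  have : t.depth ≤ t.depth - 1 := depth_le_iff.mpr fun c hc => by
    have := depth_lt_of_mem_children hc
    have := hne c hc
    omega
  omega

theorem children_eq_zero_iff {t : NTree} : t.children = 0 ↔ t.depth = 0 := by
  rw [← Nat.le_zero, depth_le_iff, Multiset.eq_zero_iff_forall_notMem]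
  simp

theorem depth_cut_le (n : ℕ) (t : NTree) : (cut n t).depth ≤ n := t.1.depth_cut_le n

@[simp] theorem cut_zero (s t : NTree) : cut 0 s = cut 0 t := rfl

theorem children_cut_succ (n : ℕ) (t : NTree) :
    (cut (n + 1) t).children = t.children.map (cut n) := by
  simp only [children, cut, OTree.cut, OTree.children_node, toM, Multiset.map_coe, List.map_map]
  refine congrArg _ (List.map_congr_left fun c hc => ?_)
  have hn := t.2.of_mem_children hc
  have h1 : nf c = ⟨c, hn⟩ := NTree.ext hn
  rw [Function.comp_apply, Function.comp_apply, h1]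
  exact NTree.ext (hn.cut n)

theorem depth_cut (n : ℕ) (t : NTree) : (cut n t).depth = min n t.depth := by
  induction n generalizing t with
  | zero => have := depth_cut_le 0 t; omega
  | succ n ih =>
    refine le_antisymm (depth_le_iff.mpr fun c hc => ?_) ?_
    · rw [children_cut_succ] at hc
      obtain ⟨d, hd, rfl⟩ := Multiset.mem_map.mp hc
      have := depth_lt_of_mem_children hd
      rw [ih]
      omega
    · rcases Nat.eq_zero_or_pos t.depth with h | h
      · omega
      · obtain ⟨d, hd, hd'⟩ := exists_mem_children_depth h.ne'
        have := depth_lt_of_mem_children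
          (t := cut (n + 1) t) (by rw [children_cut_succ]; exact Multiset.mem_map_of_mem _ hd)
        rw [ih] at this
        omega

theorem cut_cut {m n : ℕ} (h : m ≤ n) (t : NTree) : cut m (cut n t) = cut m t :=
  NTree.ext (OTree.cut_cut h t.1)

theorem cut_mono (n : ℕ) : Monotone (cut n) := fun _ _ h => OTree.code_cut_mono n h

theorem cut_eq_self {n : ℕ} {t : NTree} (h : t.depth ≤ n) : cut n t = t := by
  induction t using induction generalizing n with
  | h t ih =>
    apply children_injective
    cases n with
    | zero =>
      rw [children_eq_zero_iff.mpr (by omega : t.depth = 0)]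
      rfl
    | succ n =>
      rw [children_cut_succ, Multiset.map_congr rfl (g := id), Multiset.map_id]
      intro c hc
      exact ih c hc (by have := depth_lt_of_mem_children hc; omega)

/-! ### The product of forests -/

theorem toM_flatMap_map {A B : List OTree} {f : OTree → OTree → OTree} :
    toM (A.flatMap fun a => B.map fun b => f a b) =
      ((A : Multiset OTree) ×ˢ (B : Multiset OTree)).map fun p => nf (f p.1 p.2) := by
  rw [Multiset.coe_product, toM, Multiset.map_coe]
  congr 1
  simp [List.product, SProd.sprod, List.map_flatMap, Function.comp_def]

theorem map_product_map {α β α' β' γ : Type*} (s : Multiset α) (t : Multiset β) (f : α → α')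
    (g : β → β') (h : α' × β' → γ) :
    ((s.map f) ×ˢ (t.map g)).map h = (s ×ˢ t).map fun p => h (f p.1, g p.2) := by
  induction s using Multiset.induction with
  | empty => simp
  | cons a s ih => simp [Multiset.cons_product, ih]

theorem nf_rawMul (s t : OTree) : nf (s.rawMul t) = nf s * nf t := by
  change nf (s.rawMul t) = nf (s.normalize.rawMul t.normalize)
  induction s using OTree.induction generalizing t with
  | h cs ih =>
    have h1 : ∀ s t : OTree, s.rawMul t =
        .node (s.children.flatMap fun a => t.children.map fun b => a.rawMul b) := by
      rintro ⟨as⟩ t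
      rw [OTree.rawMul]; rfl
    rw [h1, h1, nf_node, nf_node, toM_flatMap_map, toM_flatMap_map,
      Multiset.coe_eq_coe.mpr (OTree.children_normalize_perm _),
      Multiset.coe_eq_coe.mpr (OTree.children_normalize_perm _),
      ← Multiset.map_coe, ← Multiset.map_coe, map_product_map]
    refine congrArg _ (Multiset.map_congr rfl fun p hp => ?_)
    exact ih p.1 (Multiset.mem_product.mp hp).1 p.2

theorem nf_mul (s t : OTree) : nf (s.mul t) = nf s * nf t := by
  rw [OTree.mul, nf_normalize, nf_rawMul]

theorem toM_mul (A B : List OTree) : toM (ForestData.mul A B) = fmul (toM A) (toM B) := by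
  rw [ForestData.mul, toM_flatMap_map, fmul, toM, toM, ← Multiset.map_coe, ← Multiset.map_coe,
    map_product_map]
  simp only [nf_mul]

theorem children_mul (s t : NTree) : (s * t).children = fmul s.children t.children := by
  obtain ⟨⟨as⟩, hs⟩ := s
  change (nf _).children = _
  rw [children_nf, OTree.rawMul, OTree.children_node, toM_flatMap_map, fmul]
  simp only [nf_rawMul, children, toM, ← Multiset.map_coe, map_product_map, OTree.children_node]

theorem mem_fmul {S T : Multiset NTree} {t : NTree} :
    t ∈ fmul S T ↔ ∃ a ∈ S, ∃ b ∈ T, a * b = t := by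
  simp only [fmul, Multiset.mem_map, Multiset.mem_product, Prod.exists]
  exact ⟨fun ⟨a, b, h, e⟩ => ⟨a, h.1, b, h.2, e⟩, fun ⟨a, ha, b, hb, e⟩ => ⟨a, b, ⟨ha, hb⟩, e⟩⟩

theorem mul_mem_fmul {S T : Multiset NTree} {a b : NTree} (ha : a ∈ S) (hb : b ∈ T) :
    a * b ∈ fmul S T := mem_fmul.mpr ⟨a, ha, b, hb, rfl⟩

@[simp] theorem card_fmul (S T : Multiset NTree) :
    Multiset.card (fmul S T) = Multiset.card S * Multiset.card T := by simp [fmul]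

@[simp] theorem zero_fmul (S : Multiset NTree) : fmul 0 S = 0 := rfl

@[simp] theorem fmul_zero (S : Multiset NTree) : fmul S 0 = 0 := by simp [fmul]

theorem add_fmul (S T U : Multiset NTree) : fmul (S + T) U = fmul S U + fmul T U := by
  simp [fmul, Multiset.add_product]

theorem fmul_add (S T U : Multiset NTree) : fmul S (T + U) = fmul S T + fmul S U := by
  simp [fmul, Multiset.product_add]

theorem singleton_fmul (a : NTree) (S : Multiset NTree) : fmul {a} S = S.map (a * ·) := by
  simp [fmul, ← Multiset.cons_zero, Multiset.cons_product]

theorem cons_fmul (a : NTree) (S T : Multiset NTree) :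
    fmul (a ::ₘ S) T = T.map (a * ·) + fmul S T := by
  rw [← Multiset.singleton_add, add_fmul, singleton_fmul]

theorem fmul_singleton (a : NTree) (S : Multiset NTree) : fmul S {a} = S.map (· * a) := by
  induction S using Multiset.induction with
  | empty => rfl
  | cons s S ih => rw [cons_fmul, ih]; simp

theorem fmul_cons (a : NTree) (S T : Multiset NTree) :
    fmul S (a ::ₘ T) = S.map (· * a) + fmul S T := by
  rw [← Multiset.singleton_add, fmul_add, fmul_singleton]

theorem fmul_mono {S S' T T' : Multiset NTree} (hS : S ≤ S') (hT : T ≤ T') :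
    fmul S T ≤ fmul S' T' := by
  obtain ⟨U, rfl⟩ := Multiset.le_iff_exists_add.mp hS
  obtain ⟨V, rfl⟩ := Multiset.le_iff_exists_add.mp hT
  rw [add_fmul, fmul_add, add_assoc]
  exact Multiset.le_add_right _ _

theorem fmul_comm_of {S T : Multiset NTree} (h : ∀ s ∈ S, ∀ t ∈ T, s * t = t * s) :
    fmul S T = fmul T S := by
  induction S using Multiset.induction with
  | empty => simp
  | cons a S ih =>
    rw [cons_fmul, fmul_cons, ih fun s hs => h s (Multiset.mem_cons_of_mem hs),
      Multiset.map_congr rfl (h a (Multiset.mem_cons_self a S))]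

theorem fmul_assoc_of {S T U : Multiset NTree}
    (h : ∀ s ∈ S, ∀ t u, s * t * u = s * (t * u)) : fmul (fmul S T) U = fmul S (fmul T U) := by
  induction S using Multiset.induction with
  | empty => simp
  | cons a S ih =>
    rw [cons_fmul, cons_fmul, add_fmul, ih fun s hs => h s (Multiset.mem_cons_of_mem hs)]
    congr 1
    rw [fmul, fmul, Multiset.map_map]
    conv_lhs => rw [← Multiset.map_id U, map_product_map]
    exact Multiset.map_congr rfl fun p _ => h a (Multiset.mem_cons_self a S) _ _

instance : CommSemigroup NTree where
  mul_assoc a b c := by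
    induction a using induction generalizing b c with
    | h a ih =>
      apply children_injective
      simp only [children_mul]
      exact fmul_assoc_of ih
  mul_comm a b := by
    induction a using induction generalizing b with
    | h a ih =>
      apply children_injective
      simp only [children_mul]
      exact fmul_comm_of fun s hs t _ => ih s hs t

theorem depth_mul (s t : NTree) : (s * t).depth = min s.depth t.depth := by
  induction s using induction generalizing t with
  | h s ih =>
    refine eq_of_forall_ge_iff fun n => ?_
    rw [depth_le_iff, children_mul]
    constructor
    · intro h
      by_contra! hn
      rw [lt_min_iff] at hn
      obtain ⟨c, hc, hc'⟩ := exists_mem_children_depth (t := s) (by omega)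
      obtain ⟨d, hd, hd'⟩ := exists_mem_children_depth (t := t) (by omega)
      have := h _ (mul_mem_fmul hc hd)
      rw [ih c hc] at this
      omega
    · intro h c hc
      obtain ⟨a, ha, b, hb, rfl⟩ := mem_fmul.mp hc
      rw [ih a ha]
      have := depth_lt_of_mem_children ha
      have := depth_lt_of_mem_children hb
      omega

theorem cut_mul (n : ℕ) (s t : NTree) : cut n (s * t) = cut n s * cut n t := by
  induction n generalizing s t with
  | zero => exact children_injective (by rw [children_mul]; rfl)
  | succ n ih =>
    apply children_injective
    rw [children_cut_succ, children_mul, children_mul, children_cut_succ, children_cut_succ, fmul,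
      fmul, map_product_map, Multiset.map_map]
    exact Multiset.map_congr rfl fun p _ => ih _ _

theorem cut_mul_of_depth_le {n : ℕ} {s t : NTree} (h : t.depth ≤ n) : cut n s * t = s * t := by
  rw [← cut_eq_self (t := s * t) (n := n) (by rw [depth_mul]; omega), cut_mul, cut_eq_self h]

end NTree

/-! ### Compatibility of the order with the product -/

namespace NTree

/-- The order of multisets of the same cardinality that comes from the lexicographic order of
their sorted lists: outside a common part, some element of the first multiset is smaller than all
the elements of the second one. -/
def MLT (S T : Multiset NTree) : Prop :=
  Multiset.card S = Multiset.card T ∧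
    ∃ P S' T' x, S = P + x ::ₘ S' ∧ T = P + T' ∧ ∀ t ∈ T', x < t

theorem exists_min_mem {S : Multiset NTree} (h : S ≠ 0) : ∃ x ∈ S, ∀ y ∈ S, x ≤ y := by
  have h1 : S.toFinset.Nonempty := by simpa [Finset.nonempty_iff_ne_empty] using h
  exact ⟨S.toFinset.min' h1, Multiset.mem_toFinset.mp (Finset.min'_mem _ _), fun y hy =>
    Finset.min'_le _ _ (Multiset.mem_toFinset.mpr hy)⟩

theorem MLT.exists_count {S T : Multiset NTree} (h : MLT S T) :
    ∃ z, T.count z < S.count z ∧ ∀ y < z, S.count y = T.count y := by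
  obtain ⟨-, P, S', T', x, rfl, rfl, hx⟩ := h
  obtain ⟨z, hz, hmin⟩ := exists_min_mem (S := x ::ₘ S') (Multiset.cons_ne_zero)
  have hzx := hmin x (Multiset.mem_cons_self x S')
  refine ⟨z, ?_, fun y hy => ?_⟩
  · have h1 : T'.count z = 0 :=
      Multiset.count_eq_zero_of_notMem fun hz => (hx z hz).not_ge hzx
    have h2 := Multiset.count_pos.mpr hz
    rw [Multiset.count_add, Multiset.count_add]
    omega
  · have h1 : T'.count y = 0 :=
      Multiset.count_eq_zero_of_notMem fun hz => (hx y hz).not_ge (hy.le.trans hzx)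
    have h2 : (x ::ₘ S').count y = 0 :=
      Multiset.count_eq_zero_of_notMem fun hz => (hmin y hz).not_gt hy
    rw [Multiset.count_add, Multiset.count_add, h1, h2]

theorem MLT.asymm {S T : Multiset NTree} (h : MLT S T) : ¬ MLT T S := fun h' => by
  obtain ⟨z, hz, hz'⟩ := h.exists_count
  obtain ⟨w, hw, hw'⟩ := h'.exists_count
  rcases lt_trichotomy z w with h1 | rfl | h1
  · exact hz.ne (hw' z h1)
  · exact lt_asymm hz hw
  · exact hw.ne (hz' w h1)

/-- If two trees agree up to depth `n` but not up to depth `n + 1`, then the multisets of their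
children, truncated at depth `n`, compare like the trees. -/
theorem card_lt_or_mlt_of_cut {n : ℕ} {s t : NTree} (heq : cut n s = cut n t)
    (hlt : cut (n + 1) s < cut (n + 1) t) :
    Multiset.card s.children < Multiset.card t.children ∨
      MLT (s.children.map (cut n)) (t.children.map (cut n)) := by
  have h := OTree.LevelLT.of_cut (NTree.ext_iff.mp heq) hlt
  cases n with
  | zero =>
    left
    have h2 := h.2
    simp only [OTree.levelDegrees, List.cons_lt_cons_iff, List.not_lt_nil, and_false,
      or_false] at h2
    simpa [children, toM] using h2
  | succ n =>
    right
    obtain ⟨p, x, u, q, y, v, hs, ht, hpq, hxy⟩ := h.exists_children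
    have hcard : Multiset.card s.children = Multiset.card t.children := by
      have := h.1.forall₂_children.length_eq
      simpa [children, toM] using this
    have he : ∀ r : NTree, r.children.map (cut (n + 1)) =
        toM (r.1.children.map (OTree.cut (n + 1))) := fun r => (children_cut_succ (n + 1) r).symm
    refine ⟨by simpa using hcard, toM (p.map (OTree.cut (n + 1))),
      toM (u.map (OTree.cut (n + 1))), toM ((y :: v).map (OTree.cut (n + 1))),
      nf (x.cut (n + 1)), ?_, ?_, ?_⟩
    · rw [he, hs]
      simp [toM, ← Multiset.coe_add]
    · rw [he, ht, hpq]
      simp [toM, ← Multiset.coe_add]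
    · have hnx : x.IsNormal := s.2.of_mem_children (by simp [hs])
      have hny : ∀ c ∈ y :: v, c.IsNormal := fun c hc =>
        t.2.of_mem_children (by rw [ht]; exact List.mem_append_right _ hc)
      have hsorted : ∀ c ∈ y :: v, y.code ≤ c.code := by
        have h1 := t.2
        rw [← t.1.node_children, OTree.isNormal_node_iff, ht] at h1
        have h2 := (List.pairwise_append.mp h1.2).2.1
        intro c hc
        rcases List.mem_cons.mp hc with rfl | hc
        · exact le_rfl
        · exact (List.pairwise_cons.mp h2).1 c hc
      intro t' ht'
      obtain ⟨_, hc', rfl⟩ := mem_toM.mp ht'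
      obtain ⟨c, hc, rfl⟩ := List.mem_map.mp hc'
      rw [lt_iff]
      change (OTree.normalize _).code < (OTree.normalize _).code
      rw [hnx.cut (n + 1), (hny c hc).cut (n + 1)]
      exact (hxy.cut (Nat.lt_succ_self n)).code_lt.trans_le
        (OTree.code_cut_mono _ (hsorted c hc))

theorem cut_lt_of_card_lt_or_mlt {n : ℕ} {s t : NTree} (heq : cut n s = cut n t)
    (h : Multiset.card s.children < Multiset.card t.children ∨
      MLT (s.children.map (cut n)) (t.children.map (cut n))) :
    cut (n + 1) s < cut (n + 1) t := by
  rcases lt_trichotomy (cut (n + 1) s) (cut (n + 1) t) with h1 | h1 | h1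
  · exact h1
  · have h2 := congrArg children h1
    rw [children_cut_succ, children_cut_succ] at h2
    rcases h with h | h
    · have := congrArg Multiset.card h2
      simp only [Multiset.card_map] at this
      omega
    · exact absurd (h2 ▸ h) (h2 ▸ h).asymm
  · exfalso
    have h3 := card_lt_or_mlt_of_cut heq.symm h1
    rcases h with h | h <;> rcases h3 with h3 | h3
    · omega
    · have := h3.1; simp only [Multiset.card_map] at this; omega
    · have := h.1; simp only [Multiset.card_map] at this; omega
    · exact h.asymm h3

theorem cut_lt_of_cut_lt {m n : ℕ} (hmn : m ≤ n) {s t : NTree} (h : cut m s < cut m t) :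
    cut n s < cut n t := by
  by_contra hn
  have := cut_mono m (not_lt.mp hn)
  rw [cut_cut hmn, cut_cut hmn] at this
  exact this.not_gt h

/-- The factors are first truncated at the depth of `c`; then they are equal, or the strict
compatibility `H` applies. -/
theorem mul_le_mul_of_cut_lt {n : ℕ}
    (H : ∀ j ≤ n, ∀ a b c : NTree, j ≤ c.depth → cut j a < cut j b → cut j (a * c) < cut j (b * c))
    {a b c : NTree} (hc : c.depth ≤ n) (hab : a ≤ b) : a * c ≤ b * c := by
  rw [← cut_mul_of_depth_le (le_refl c.depth), ← cut_mul_of_depth_le (s := b) (le_refl c.depth)]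
  rcases (cut_mono c.depth hab).lt_or_eq with h | h
  · have h1 := H c.depth hc (cut c.depth a) (cut c.depth b) c le_rfl
      (by rwa [cut_cut le_rfl, cut_cut le_rfl])
    rw [cut_eq_self (t := cut c.depth a * c) (by rw [depth_mul]; omega),
      cut_eq_self (t := cut c.depth b * c) (by rw [depth_mul]; omega)] at h1
    exact h1.le
  · rw [h]

/-- If two trees agree up to depth `n + 1`, so do, up to depth `n`, their children; this remains
true once a common part of the children is removed. -/
theorem map_eq_map_of_cut_eq {n : ℕ} {s t : NTree} {P S T : Multiset NTree}
    (heq : cut (n + 1) s = cut (n + 1) t) (hs : s.children.map (cut (n + 1)) = P + S)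
    (ht : t.children.map (cut (n + 1)) = P + T) : S.map (cut n) = T.map (cut n) := by
  have h1 : ∀ r : NTree, (r.children.map (cut (n + 1))).map (cut n) = r.children.map (cut n) :=
    fun r => by
      rw [Multiset.map_map]
      exact Multiset.map_congr rfl fun c _ => cut_cut (Nat.le_succ n) c
  have h2 := congrArg children heq
  rw [children_cut_succ, children_cut_succ, ← h1 s, ← h1 t, hs, ht, Multiset.map_add,
    Multiset.map_add] at h2
  exact add_left_cancel h2

/-- Multiplication by a tree that is deep enough preserves the strict order of truncations. -/
theorem cut_mul_lt_cut_mul {n : ℕ} {a b c : NTree} (hc : n ≤ c.depth) (hab : cut n a < cut n b) :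
    cut n (a * c) < cut n (b * c) := by
  induction n using Nat.strong_induction_on generalizing a b c with
  | _ n ih =>
  cases n with
  | zero => exact absurd hab (by rw [cut_zero a b]; exact lt_irrefl _)
  | succ n =>
  have H : ∀ j ≤ n, ∀ a b c : NTree, j ≤ c.depth → cut j a < cut j b →
      cut j (a * c) < cut j (b * c) := fun j hj a b c h1 h2 => ih j (by omega) h1 h2
  rcases (cut_mono n hab.le).lt_or_eq with hlt | heq
  · rw [cut_cut (Nat.le_succ n), cut_cut (Nat.le_succ n)] at hlt
    exact cut_lt_of_cut_lt (Nat.le_succ n) (H n le_rfl a b c (by omega) hlt)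
  rw [cut_cut (Nat.le_succ n), cut_cut (Nat.le_succ n)] at heq
  obtain ⟨c₁, hc₁, hdc₁⟩ := exists_mem_children_depth (t := c) (by omega)
  refine cut_lt_of_card_lt_or_mlt (by rw [cut_mul, cut_mul, heq]) ?_
  rw [children_mul, children_mul, card_fmul, card_fmul]
  refine (card_lt_or_mlt_of_cut heq hab).imp (fun h => ?_) fun h => ?_
  · exact Nat.mul_lt_mul_of_pos_right h (Multiset.card_pos_iff_exists_mem.mpr ⟨c₁, hc₁⟩)
  · refine ⟨by
      have := h.1
      simp only [Multiset.card_map] at this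
      simp only [Multiset.card_map, card_fmul, this], ?_⟩
    obtain ⟨-, P, S', T', x, hS, hT, hx⟩ := h
    have hmap : ∀ S T : Multiset NTree, (fmul S T).map (cut n) =
        fmul (S.map (cut n)) (T.map (cut n)) := fun S T => by
      rw [fmul, fmul, map_product_map, Multiset.map_map]
      exact Multiset.map_congr rfl fun p _ => cut_mul n _ _
    -- The children of `c` of depth less than `n` do not see where `a` and `b` differ.
    let F := (c.children.map (cut n)).filter fun d => n ≤ d.depth
    let L := (c.children.map (cut n)).filter fun d => ¬ n ≤ d.depth
    have hFL : F + L = c.children.map (cut n) := Multiset.filter_add_not _ _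
    have hF : ∀ d ∈ F, d.depth = n := fun d hd => by
      obtain ⟨h1, h2⟩ := Multiset.mem_filter.mp hd
      obtain ⟨e, _, rfl⟩ := Multiset.mem_map.mp h1
      exact le_antisymm (depth_cut_le _ _) h2
    have hL : fmul (x ::ₘ S') L = fmul T' L := by
      cases n with
      | zero =>
        have : L = 0 := Multiset.eq_zero_of_forall_notMem fun d hd => by simp [L] at hd
        rw [this, fmul_zero, fmul_zero]
      | succ n =>
        have h1 := map_eq_map_of_cut_eq heq hS hT
        have h2 : ∀ S, fmul S L = fmul (S.map (cut n)) L := fun S => by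
          rw [fmul, fmul]
          conv_rhs => rw [← Multiset.map_id L, map_product_map]
          refine Multiset.map_congr rfl fun p hp => (cut_mul_of_depth_le ?_).symm
          exact Nat.le_of_lt_succ (not_le.mp
            (Multiset.mem_filter.mp (Multiset.mem_product.mp hp).2).2)
        rw [h2, h1, ← h2]
    have hFne : F ≠ 0 := fun h0 => by
      have : cut n c₁ ∈ F := Multiset.mem_filter.mpr
        ⟨Multiset.mem_map_of_mem _ hc₁, by rw [depth_cut]; omega⟩
      rw [h0] at this
      exact Multiset.notMem_zero _ this
    -- The product of `x` and of the smallest deep child of `c` is smaller than all the products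
    -- that are left on the other side.
    obtain ⟨c₀, hc₀, hmin⟩ := exists_min_mem hFne
    have hxF : x * c₀ ∈ fmul (x ::ₘ S') F := mul_mem_fmul (Multiset.mem_cons_self _ _) hc₀
    obtain ⟨S'', hS''⟩ := Multiset.exists_cons_of_mem hxF
    refine ⟨fmul P (F + L) + fmul T' L, S'', fmul T' F, x * c₀, ?_, ?_, ?_⟩
    · rw [hmap, hS, ← hFL, add_fmul, fmul_add (x ::ₘ S'), hL, hS'']
      abel
    · rw [hmap, hT, ← hFL, add_fmul, fmul_add T']
      abel
    · intro t ht
      obtain ⟨y, hy, d, hd, rfl⟩ := mem_fmul.mp ht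
      have hdep : ∀ z : NTree, (∃ r : NTree, z ∈ r.children.map (cut n)) → z.depth ≤ n := by
        rintro z ⟨r, hz⟩
        obtain ⟨w, _, rfl⟩ := Multiset.mem_map.mp hz
        exact depth_cut_le _ _
      have hxn := hdep x ⟨a, by rw [hS]; simp⟩
      have hyn := hdep y ⟨b, by rw [hT]; simp [hy]⟩
      have h1 : cut n x < cut n y := by
        rw [cut_eq_self hxn, cut_eq_self hyn]; exact hx y hy
      have h2 := H n le_rfl x y c₀ (hF c₀ hc₀).ge h1
      rw [cut_eq_self (by rw [depth_mul]; omega), cut_eq_self (by rw [depth_mul]; omega)] at h2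
      refine h2.trans_le ?_
      rw [mul_comm y, mul_comm y]
      exact mul_le_mul_of_cut_lt H hyn (hmin d hd)

theorem mul_le_mul_of_le_left {a b : NTree} (h : a ≤ b) (c : NTree) : a * c ≤ b * c :=
  mul_le_mul_of_cut_lt (n := c.depth) (fun _ _ _ _ _ => cut_mul_lt_cut_mul) le_rfl h

theorem mul_le_mul_of_le {a b c d : NTree} (hab : a ≤ b) (hcd : c ≤ d) : a * c ≤ b * d := by
  refine (mul_le_mul_of_le_left hab c).trans ?_
  rw [mul_comm b, mul_comm b]
  exact mul_le_mul_of_le_left hcd b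

theorem mul_lt_mul_of_lt {a b c : NTree} (h : a < b) (ha : a.depth ≤ c.depth)
    (hb : b.depth ≤ c.depth) : a * c < b * c := by
  have := cut_mul_lt_cut_mul (n := c.depth) le_rfl (a := a) (b := b)
    (by rwa [cut_eq_self ha, cut_eq_self hb])
  rwa [cut_eq_self (by rw [depth_mul]; omega), cut_eq_self (by rw [depth_mul]; omega)] at this

end NTree

/-! ### Powers -/

namespace NTree

/-- The path of length `d`. -/
def path (d : ℕ) : NTree := nf (.path d)

theorem children_path_zero : (path 0).children = 0 := by
  rw [path, children_nf, OTree.path]; rfl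

theorem children_path_succ (d : ℕ) : (path (d + 1)).children = {path d} := by
  rw [path, children_nf, OTree.path]; rfl

theorem depth_path (d : ℕ) : (path d).depth = d := by
  induction d with
  | zero => rw [← children_eq_zero_iff, children_path_zero]
  | succ d ih =>
    refine eq_of_forall_ge_iff fun n => ?_
    rw [depth_le_iff, children_path_succ]
    simp [ih]

theorem path_mul (d : ℕ) (t : NTree) : path d * t = cut d t := by
  induction d generalizing t with
  | zero =>
    apply children_injective
    rw [children_mul, children_path_zero]
    rfl
  | succ d ih =>
    apply children_injective
    rw [children_mul, children_path_succ, singleton_fmul, children_cut_succ]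
    simp only [ih]

theorem path_mul_of_depth_le {d : ℕ} {t : NTree} (h : t.depth ≤ d) : path d * t = t := by
  rw [path_mul, cut_eq_self h]

/-- The powers of a tree, with the convention that the power with exponent `0` is a path. -/
def tpow (t : NTree) : ℕ → NTree
  | 0 => path t.depth
  | n + 1 => tpow t n * t

/-- The power of a forest with exponent `n + 1`. The shift of the exponent avoids the convention
on the exponent `0`. -/
def fpow (S : Multiset NTree) : ℕ → Multiset NTree
  | 0 => S
  | n + 1 => fmul (fpow S n) S

theorem tpow_one (t : NTree) : tpow t 1 = t := path_mul_of_depth_le le_rfl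

@[simp] theorem depth_tpow (t : NTree) (n : ℕ) : (tpow t n).depth = t.depth := by
  induction n with
  | zero => exact depth_path _
  | succ n ih => rw [tpow, depth_mul, ih, min_self]

theorem nf_pow (t : OTree) (n : ℕ) : nf (t.pow n) = tpow (nf t) n := by
  induction n with
  | zero => rw [OTree.pow, tpow, depth_nf, path]
  | succ n ih => rw [OTree.pow, tpow, nf_mul, ih]

theorem val_tpow (t : NTree) (n : ℕ) : (tpow t n).val = t.val.pow n := by
  have hp : ∀ d : ℕ, (OTree.path d).IsNormal := by
    intro d
    induction d with
    | zero => exact OTree.isNormal_node_iff.mpr ⟨by simp, .nil⟩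
    | succ d ih =>
      exact OTree.isNormal_node_iff.mpr ⟨by simpa using ih, List.pairwise_singleton _ _⟩
  have hn : (t.val.pow n).IsNormal := by
    cases n with
    | zero => exact hp _
    | succ n => exact OTree.normalize_normalize _
  rw [← nf_val t, ← nf_pow, nf_val]
  exact hn

theorem children_tpow_succ (t : NTree) (n : ℕ) :
    (tpow t (n + 1)).children = fpow t.children n := by
  induction n with
  | zero => rw [tpow_one, fpow]
  | succ n ih => rw [tpow, children_mul, ih, fpow]

theorem tpow_le_tpow {a b : NTree} (h : a ≤ b) (n : ℕ) : tpow a (n + 1) ≤ tpow b (n + 1) := by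
  induction n with
  | zero => rwa [tpow_one, tpow_one]
  | succ n ih => exact mul_le_mul_of_le ih h

theorem tpow_lt_tpow {a b : NTree} (h : a < b) (hd : a.depth ≤ b.depth) (n : ℕ) :
    tpow a (n + 1) < tpow b (n + 1) := by
  rcases hd.lt_or_eq with hd | hd
  -- If the depths differ, so do the powers, and a weak inequality is enough.
  · refine (tpow_le_tpow h.le n).lt_of_ne fun he => ?_
    have := congrArg depth he
    rw [depth_tpow, depth_tpow] at this
    omega
  · induction n with
    | zero => rwa [tpow_one, tpow_one]
    | succ n ih =>
      refine (mul_lt_mul_of_lt ih ?_ ?_).trans_le (mul_le_mul_of_le le_rfl h.le)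
      · rw [depth_tpow]
      · rw [depth_tpow]; omega

theorem tpow_succ_injective {a b : NTree} {n : ℕ} (h : tpow a (n + 1) = tpow b (n + 1)) :
    a = b := by
  have hd := congrArg depth h
  rw [depth_tpow, depth_tpow] at hd
  rcases lt_trichotomy a b with h1 | h1 | h1
  · exact absurd h (tpow_lt_tpow h1 hd.le n).ne
  · exact h1
  · exact absurd h (tpow_lt_tpow h1 hd.ge n).ne'

theorem tpow_path (d n : ℕ) : tpow (path d) n = path d := by
  induction n with
  | zero => rw [tpow, depth_path]
  | succ n ih => rw [tpow, ih, path_mul_of_depth_le (depth_path d).le]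

@[simp] theorem fpow_zero_left (n : ℕ) : fpow 0 n = 0 := by
  cases n with
  | zero => rfl
  | succ n => exact fmul_zero _

theorem card_fpow (S : Multiset NTree) (n : ℕ) :
    Multiset.card (fpow S n) = Multiset.card S ^ (n + 1) := by
  induction n with
  | zero => simp [fpow]
  | succ n ih => rw [fpow, card_fmul, ih, ← pow_succ]

theorem fpow_singleton (t : NTree) (n : ℕ) : fpow {t} n = {tpow t (n + 1)} := by
  induction n with
  | zero => rw [fpow, tpow_one]
  | succ n ih => rw [fpow, ih, singleton_fmul, Multiset.map_singleton]; rfl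

theorem fpow_mono {S T : Multiset NTree} (h : S ≤ T) (n : ℕ) : fpow S n ≤ fpow T n := by
  induction n with
  | zero => exact h
  | succ n ih => exact fmul_mono ih h

/-- This justifies the special treatment of paths by the procedure `root`. -/
theorem eq_of_fpow_eq_path {X : Multiset NTree} {n d : ℕ} (h : fpow X n = {path d}) :
    X = {path d} := by
  have h1 : Multiset.card X = 1 := by
    have := congrArg Multiset.card h
    rw [card_fpow, Multiset.card_singleton] at this
    exact (Nat.pow_eq_one.mp this).resolve_right (Nat.succ_ne_zero n)
  obtain ⟨x, rfl⟩ := Multiset.card_eq_one.mp h1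
  rw [fpow_singleton, Multiset.singleton_inj] at h
  rw [tpow_succ_injective (h.trans (tpow_path d (n + 1)).symm)]

theorem tpow_succ_le_of_mem_fpow {R : Multiset NTree} {D n : ℕ} {m t : NTree}
    (hm : ∀ y ∈ R, D ≤ y.depth → m ≤ y) (ht : t ∈ fpow R n) (hD : D ≤ t.depth) :
    tpow m (n + 1) ≤ t := by
  induction n generalizing t with
  | zero => rw [tpow_one]; exact hm t ht hD
  | succ n ih =>
    obtain ⟨a, ha, b, hb, rfl⟩ := mem_fmul.mp ht
    rw [depth_mul] at hD
    exact mul_le_mul_of_le (ih ha (by omega)) (hm b hb (by omega))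

/-- The smallest of the trees of depth at least `D` in the difference of the powers of two forests
`R + Y` and `R` is the product of `Y`'s smallest such tree and of a power of the smallest such
tree of `R + Y`. -/
theorem exists_fpow_add_eq {R Y : Multiset NTree} {D : ℕ} {m y : NTree} (hm : m ∈ R + Y)
    (hy : y ∈ Y) (hm_min : ∀ z ∈ R + Y, D ≤ z.depth → m ≤ z)
    (hy_min : ∀ z ∈ Y, D ≤ z.depth → y ≤ z) (hd : y.depth ≤ m.depth) (n : ℕ) :
    ∃ G, fpow (R + Y) n = fpow R n + G ∧ tpow m n * y ∈ G ∧
      ∀ t ∈ G, (∃ z ∈ Y, t.depth ≤ z.depth) ∧ (D ≤ t.depth → tpow m n * y ≤ t) := by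
  induction n with
  | zero =>
    refine ⟨Y, rfl, ?_, fun t ht => ⟨⟨t, ht, le_rfl⟩, fun hD => ?_⟩⟩
    · rwa [tpow, path_mul_of_depth_le hd]
    · rw [tpow, path_mul_of_depth_le hd]; exact hy_min t ht hD
  | succ n ih =>
    obtain ⟨G, hG, hmem, hall⟩ := ih
    have hcomm : tpow m (n + 1) * y = tpow m n * y * m := by rw [tpow, mul_right_comm]
    refine ⟨fmul G (R + Y) + fmul (fpow R n) Y, ?_, ?_, fun t ht => ?_⟩
    · rw [fpow, hG, add_fmul, fmul_add (fpow R n), fpow]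
      abel
    · rw [hcomm]
      exact Multiset.mem_add.mpr (.inl (mul_mem_fmul hmem hm))
    · rcases Multiset.mem_add.mp ht with ht | ht
      · obtain ⟨a, ha, b, hb, rfl⟩ := mem_fmul.mp ht
        obtain ⟨⟨z, hz, hz'⟩, h2⟩ := hall a ha
        rw [depth_mul, hcomm]
        exact ⟨⟨z, hz, by omega⟩, fun hD =>
          mul_le_mul_of_le (h2 (by omega)) (hm_min b hb (by omega))⟩
      · obtain ⟨a, ha, b, hb, rfl⟩ := mem_fmul.mp ht
        rw [depth_mul]
        refine ⟨⟨b, hb, by omega⟩, fun hD => mul_le_mul_of_le ?_ (hy_min b hb (by omega))⟩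
        exact tpow_succ_le_of_mem_fpow
          (fun z hz => hm_min z (Multiset.mem_add.mpr (.inl hz))) ha (by omega)

/-- The smallest of the deepest trees of a nonempty forest. -/
theorem exists_min_deepest {Y : Multiset NTree} (h : Y ≠ 0) :
    ∃ y ∈ Y, (∀ z ∈ Y, z.depth ≤ y.depth) ∧ ∀ z ∈ Y, y.depth ≤ z.depth → y ≤ z := by
  obtain ⟨w, hw, hw'⟩ : ∃ w ∈ Y, ∀ z ∈ Y, z.depth ≤ w.depth := by
    obtain ⟨w, hw, hw'⟩ := Y.toFinset.exists_max_image depth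
      (by simpa [Finset.nonempty_iff_ne_empty] using h)
    exact ⟨w, by simpa using hw, by simpa using hw'⟩
  obtain ⟨y, hy, hmin⟩ := exists_min_mem (S := Y.filter fun z => w.depth ≤ z.depth) fun h0 =>
    Multiset.notMem_zero w (h0 ▸ Multiset.mem_filter.mpr ⟨hw, le_rfl⟩)
  obtain ⟨hy1, hy2⟩ := Multiset.mem_filter.mp hy
  exact ⟨y, hy1, fun z hz => (hw' z hz).trans hy2, fun z hz hz' =>
    hmin z (Multiset.mem_filter.mpr ⟨hz, hy2.trans hz'⟩)⟩

/-! ### Forests of trees in normal form -/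

/-- All the trees of the forest are in normal form. -/
def NormalList (F : List OTree) : Prop := ∀ t ∈ F, t.IsNormal

theorem NormalList.exists_eq_map {F : List OTree} (h : NormalList F) :
    F = (F.map nf).map val := by
  rw [List.map_map]
  conv_lhs => rw [← List.map_id F]
  exact List.map_congr_left fun t ht => (h t ht).symm

theorem NormalList.val_mem {F : List OTree} (h : NormalList F) {t : NTree} :
    t.val ∈ F ↔ t ∈ toM F := by
  rw [mem_toM]
  refine ⟨fun ht => ⟨_, ht, nf_val t⟩, ?_⟩
  rintro ⟨s, hs, rfl⟩
  rwa [show (nf s).val = s from h s hs]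

theorem normalList_children (t : NTree) : NormalList t.val.children := fun _ hc =>
  t.isNormal.of_mem_children hc

theorem normalList_mul (A B : List OTree) : NormalList (ForestData.mul A B) := by
  intro t ht
  simp only [ForestData.mul, List.mem_flatMap, List.mem_map] at ht
  obtain ⟨a, -, b, -, rfl⟩ := ht
  exact OTree.normalize_normalize _

theorem NormalList.diff {A : List OTree} (h : NormalList A) (B : List OTree) :
    NormalList (A.diff B) := fun t ht => h t (List.diff_subset A B ht)

theorem val_injective : Function.Injective val := fun _ _ h => NTree.ext h

theorem toM_diff {A B : List OTree} (hA : NormalList A) (hB : NormalList B) :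
    toM (A.diff B) = toM A - toM B := by
  conv_lhs => rw [hA.exists_eq_map, hB.exists_eq_map, ← List.map_diff val_injective, toM_map_val]
  rw [toM, toM, Multiset.coe_sub]

theorem subperm_iff {A B : List OTree} (hA : NormalList A) (hB : NormalList B) :
    A.Subperm B ↔ toM A ≤ toM B := by
  refine ⟨fun h => ?_, fun h => ?_⟩
  · rw [hA.exists_eq_map, hB.exists_eq_map, List.map_subperm_map_iff val_injective] at h
    exact Multiset.coe_le.mpr h
  · rw [hA.exists_eq_map, hB.exists_eq_map, List.map_subperm_map_iff val_injective]
    exact Multiset.coe_le.mp h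

theorem depth_forest_le_iff {F : List OTree} {n : ℕ} :
    ForestData.depth F ≤ n ↔ ∀ t ∈ toM F, t.depth ≤ n := by
  have : (∀ t ∈ toM F, t.depth ≤ n) ↔ ∀ t ∈ F, t.depth ≤ n := by simp [mem_toM, depth_nf]
  rw [this, ForestData.depth]
  induction F with
  | nil => simp
  | cons t F ih => simp [ih (by simp [mem_toM, depth_nf])]

theorem toM_pow (F : List OTree) (n : ℕ) :
    toM (ForestData.pow F (n + 1)) = fpow (toM F) n := by
  induction n with
  | zero =>
    rw [ForestData.pow, ForestData.pow, toM_mul, fpow]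
    change fmul {path _} _ = _
    rw [singleton_fmul, Multiset.map_congr rfl (g := id), Multiset.map_id]
    exact fun t ht => path_mul_of_depth_le (depth_forest_le_iff.mp le_rfl t ht)
  | succ n ih => rw [ForestData.pow, toM_mul, ih, fpow]

theorem normalList_pow (F : List OTree) (n : ℕ) : NormalList (ForestData.pow F (n + 1)) :=
  normalList_mul _ _

theorem minDeep_eq_some {F : List OTree} (hF : NormalList F) {d : ℕ} {x : NTree}
    (hx : x ∈ toM F) (hd : d ≤ x.depth) (hmin : ∀ y ∈ toM F, d ≤ y.depth → x ≤ y) :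
    ForestData.minDeep d F = some x.val := by
  have hx' : x.val ∈ F.filter fun t => decide (d ≤ t.depth) :=
    List.mem_filter.mpr ⟨hF.val_mem.mpr hx, decide_eq_true hd⟩
  cases h : ForestData.minDeep d F with
  | none =>
    rw [ForestData.minDeep, List.argmin_eq_none] at h
    rw [h] at hx'
    simp at hx'
  | some t =>
    rw [ForestData.minDeep] at h
    have h1 := List.mem_filter.mp (List.argmin_mem h)
    have h2 : t.code ≤ x.val.code := not_lt.mp (List.not_lt_of_mem_argmin hx' h)
    have h3 : x ≤ nf t := hmin _ (mem_toM.mpr ⟨t, h1.1, rfl⟩)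
      (by rw [depth_nf]; exact of_decide_eq_true h1.2)
    have h4 : (nf t).val = t := hF t h1.1
    rw [le_iff, h4] at h3
    rw [OTree.code_injective (le_antisymm h2 h3)]

/-- The choice made by the algorithms: a tree `x` of maximal depth that is the smallest such. -/
theorem minDeep_depth_eq_some {F : List OTree} (hF : NormalList F) {x : NTree} (hx : x ∈ toM F)
    (hmax : ∀ y ∈ toM F, y.depth ≤ x.depth) (hmin : ∀ y ∈ toM F, x.depth ≤ y.depth → x ≤ y) :
    ForestData.minDeep (ForestData.depth F) F = some x.val := by
  have h : ForestData.depth F = x.depth :=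
    le_antisymm (depth_forest_le_iff.mpr hmax) (depth_forest_le_iff.mp le_rfl x hx)
  exact minDeep_eq_some hF hx h.le fun y hy hd => hmin y hy (h ▸ hd)

theorem eq_nil_of_minDeep_depth_eq_none {F : List OTree}
    (h : ForestData.minDeep (ForestData.depth F) F = none) : F = [] := by
  rw [ForestData.minDeep, List.argmin_eq_none, List.filter_eq_nil_iff] at h
  by_contra hne
  have hne : toM F ≠ 0 := by simpa [toM] using hne
  obtain ⟨y, hy, hy', -⟩ := exists_min_deepest hne
  obtain ⟨s, hs, rfl⟩ := mem_toM.mp hy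
  refine h s hs (decide_eq_true ?_)
  rw [← depth_nf s]
  exact depth_forest_le_iff.mpr hy'

theorem toM_eq_zero_iff {F : List OTree} : toM F = 0 ↔ F = [] := by simp [toM]

end NTree
/-! ### Division of trees and roots of forests -/

namespace ForestData

open NTree

/-- The recursive equation of `divideLoop`, free of the termination proofs. -/
theorem divideLoop_eq (A B C : List OTree) : divideLoop A B C =
    match minDeep (depth (A.diff (mul B C))) (A.diff (mul B C)) with
    | none => some C
    | some ts => (minDeep ts.depth B).bind fun tb =>
        (divideLoop ts.children tb.children []).bind fun q =>
          if List.Subperm (mul B ((OTree.node q).normalize :: C)) A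
          then divideLoop A B ((OTree.node q).normalize :: C) else none := by
  rw [divideLoop]
  dsimp only
  split
  · next h => rw [h]
  · next ts h =>
    rw [h]
    dsimp only
    split
    · next h => rw [h]; rfl
    · next tb h =>
      rw [h, Option.bind_some]
      split
      · next h => rw [h]; rfl
      · next q h => rw [h, Option.bind_some]; split_ifs <;> rfl

/-- The recursive equation of `rootLoop`, free of the termination proofs. -/
theorem rootLoop_eq (k : ℕ) (hk : 0 < k) (A R : List OTree) (tm : Option OTree) :
    rootLoop k hk A R tm =
    match minDeep (depth (A.diff (pow R k))) (A.diff (pow R k)) with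
    | none => some R
    | some ts =>
      if tm.all fun m => decide (ts.code < (m.pow k).code) then
        (root k hk ts.children).bind fun r =>
          if List.Subperm (pow ((OTree.node r).normalize :: R) k) A then
            rootLoop k hk A ((OTree.node r).normalize :: R) (some (OTree.node r).normalize)
          else none
      else
        (tm.bind fun m => divide ts (m.pow (k - 1))).bind fun ti =>
          if List.Subperm (pow (ti :: R) k) A then rootLoop k hk A (ti :: R) tm else none := by
  rw [rootLoop]
  dsimp only
  split
  · next h => rw [h]
  · next ts h =>
    rw [h]
    dsimp only
    split
    · split
      · next h => rw [h]; rfl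
      · next r h => rw [h, Option.bind_some]; split_ifs <;> rfl
    · split
      · next h => rw [h]; rfl
      · next r h => rw [h, Option.bind_some]; split_ifs <;> rfl

/-- The division of forests finds every quotient that is not deeper than the divisor. -/
theorem exists_divideLoop_eq_some (A B : List OTree) (X : Multiset NTree) (hA : NormalList A)
    (hB : NormalList B) (hX : toM A = fmul (toM B) X)
    (hd : ∀ x ∈ X, ∃ b ∈ toM B, x.depth ≤ b.depth) (C : List OTree) (Y : Multiset NTree)
    (hC : X = toM C + Y) : ∃ q, divideLoop A B C = some q ∧ toM q = X := by
  rcases Multiset.empty_or_exists_mem Y with rfl | hY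
  · have h : toM (A.diff (mul B C)) = 0 := by
      rw [toM_diff hA (normalList_mul _ _), toM_mul, hX, hC, add_zero, tsub_self]
    refine ⟨C, ?_, by rw [hC, add_zero]⟩
    rw [divideLoop_eq, toM_eq_zero_iff.mp h]
    rfl
  · have hF : toM (A.diff (mul B C)) = fmul (toM B) Y := by
      rw [toM_diff hA (normalList_mul _ _), toM_mul, hX, hC, fmul_add, add_tsub_cancel_left]
    obtain ⟨y, hy, hy_max, hy_min⟩ := exists_min_deepest (Y := Y) (by
      rintro rfl; exact Multiset.notMem_zero _ hY.choose_spec)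
    -- The smallest deepest tree of the rest of `A` is `b * y`, where `b` is the smallest tree of
    -- `B` that is at least as deep as `y`.
    obtain ⟨b₀, hb₀, hdb₀⟩ := hd y (by rw [hC]; exact Multiset.mem_add.mpr (.inr hy))
    obtain ⟨b, hb, hb_min⟩ := exists_min_mem (S := (toM B).filter fun b => y.depth ≤ b.depth)
      fun h0 => Multiset.notMem_zero b₀ (h0 ▸ Multiset.mem_filter.mpr ⟨hb₀, hdb₀⟩)
    obtain ⟨hbB, hyb⟩ := Multiset.mem_filter.mp hb
    have hdby : (b * y).depth = y.depth := by rw [depth_mul]; omega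
    have hbyA : b * y ∈ toM A := by
      rw [hX, hC]
      exact mul_mem_fmul hbB (Multiset.mem_add.mpr (.inr hy))
    have hs : minDeep (depth (A.diff (mul B C))) (A.diff (mul B C)) = some (b * y).val := by
      refine minDeep_depth_eq_some (hA.diff _) ?_ ?_ ?_
      · rw [hF]; exact mul_mem_fmul hbB hy
      · rw [hF]
        intro t ht
        obtain ⟨c, hc, z, hz, rfl⟩ := mem_fmul.mp ht
        have := hy_max z hz
        rw [depth_mul, hdby]
        omega
      · rw [hF, hdby]
        intro t ht hdt
        obtain ⟨c, hc, z, hz, rfl⟩ := mem_fmul.mp ht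
        rw [depth_mul] at hdt
        exact mul_le_mul_of_le (hb_min c (Multiset.mem_filter.mpr ⟨hc, by omega⟩))
          (hy_min z hz (by omega))
    have ht : minDeep (b * y).val.depth B = some b.val := by
      change minDeep (b * y).depth B = _
      rw [hdby]
      exact minDeep_eq_some hB hbB hyb fun c hc hc' => hb_min c (Multiset.mem_filter.mpr ⟨hc, hc'⟩)
    have hlt : sizeOf (b * y).val.children < sizeOf A :=
      sizeOf_children_lt (hA.val_mem.mpr hbyA)
    obtain ⟨q, hq, hq'⟩ := exists_divideLoop_eq_some (b * y).val.children b.val.children y.children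
      (normalList_children _) (normalList_children _) (children_mul b y)
      (fun x hx => by
        have h1 := depth_lt_of_mem_children hx
        obtain ⟨c, hc, hc'⟩ := exists_mem_children_depth (t := b) (by omega)
        exact ⟨c, hc, by omega⟩) [] y.children (by simp [toM])
    have hnf : nf (OTree.node q).normalize = y := by
      rw [nf_normalize, nf_node, hq', node_children]
    have hcons : toM ((OTree.node q).normalize :: C) = y ::ₘ toM C := by
      rw [toM, List.map_cons, hnf]; rfl
    have hXe : X = toM ((OTree.node q).normalize :: C) + Y.erase y := by
      rw [hcons, Multiset.cons_add, ← Multiset.add_cons, Multiset.cons_erase hy, hC]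
    have hcard : Multiset.card (Y.erase y) < Multiset.card Y := Multiset.card_erase_lt_of_mem hy
    have hsub : List.Subperm (mul B ((OTree.node q).normalize :: C)) A := by
      rw [subperm_iff (normalList_mul _ _) hA, toM_mul, hX]
      refine fmul_mono le_rfl ?_
      conv_rhs => rw [hXe]
      exact Multiset.le_add_right _ _
    obtain ⟨r, hr, hr'⟩ := exists_divideLoop_eq_some A B X hA hB hX hd
      ((OTree.node q).normalize :: C) (Y.erase y) hXe
    refine ⟨r, ?_, hr'⟩
    rw [divideLoop_eq, hs]
    simp only [ht, hq, Option.bind_some, if_pos hsub, hr]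
termination_by (sizeOf A, Multiset.card Y)

/-- The division of trees finds every quotient that is not deeper than the divisor. -/
theorem exists_divide_eq_some (b y : NTree) (hd : y.depth ≤ b.depth) :
    divide (b * y).val b.val = some y.val := by
  obtain ⟨q, hq, hq'⟩ := exists_divideLoop_eq_some (b * y).val.children b.val.children y.children
    (normalList_children _) (normalList_children _) (children_mul b y)
    (fun x hx => by
      have h1 := depth_lt_of_mem_children hx
      obtain ⟨c, hc, hc'⟩ := exists_mem_children_depth (t := b) (by omega)
      exact ⟨c, hc, by omega⟩) [] y.children (by simp [toM])
  rw [divide, hq, Option.map_some]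
  change some (nf (.node q)).val = _
  rw [nf_node, hq', node_children]

/-- The last test of the loop makes sure that its answer is a root. -/
theorem toM_eq_of_rootLoop_eq_some {n : ℕ} {hn : 0 < n + 1} {A R Q : List OTree}
    {tm : Option OTree} (hA : NormalList A) (hR : List.Subperm (pow R (n + 1)) A)
    (h : rootLoop (n + 1) hn A R tm = some Q) : fpow (toM Q) n = toM A := by
  rw [rootLoop_eq] at h
  split at h
  · next hs =>
    rw [Option.some.injEq] at h
    subst h
    have h1 := eq_nil_of_minDeep_depth_eq_none hs
    rw [← toM_eq_zero_iff, toM_diff hA (normalList_pow _ _), toM_pow, tsub_eq_zero_iff_le] at h1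
    rw [subperm_iff (normalList_pow _ _) hA, toM_pow] at hR
    exact le_antisymm hR h1
  · have hdec : ∀ t, List.Subperm (pow (t :: R) (n + 1)) A →
        A.length - (t :: R).length < A.length - R.length := fun t hle => by
      have h1 := hle.length_le
      rw [length_pow, List.length_cons] at h1
      have h2 := Nat.le_self_pow (show n + 1 ≠ 0 by omega) (R.length + 1)
      simp only [List.length_cons]
      omega
    split_ifs at h with hc
    · obtain ⟨r, -, h⟩ := Option.bind_eq_some_iff.mp h
      split_ifs at h with hle
      have := hdec _ hle
      exact toM_eq_of_rootLoop_eq_some hA hle h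
    · obtain ⟨t, -, h⟩ := Option.bind_eq_some_iff.mp h
      split_ifs at h with hle
      have := hdec _ hle
      exact toM_eq_of_rootLoop_eq_some hA hle h
termination_by A.length - R.length

/-- Every answer of the procedure is a root. -/
theorem toM_eq_of_root_eq_some {n : ℕ} {hn : 0 < n + 1} {A Q : List OTree} (hA : NormalList A)
    (h : root (n + 1) hn A = some Q) : fpow (toM Q) n = toM A := by
  rw [root] at h
  split_ifs at h with hp
  · rw [Option.some.injEq] at h
    subst h
    rw [hp]
    change fpow {path _} n = {path _}
    rw [fpow_singleton, tpow_path]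
  · refine toM_eq_of_rootLoop_eq_some hA ?_ h
    rw [subperm_iff (normalList_pow _ _) hA, toM_pow]
    change fpow 0 n ≤ _
    rw [fpow_zero_left]
    exact Multiset.zero_le _

mutual

/-- The procedure finds every root. -/
theorem exists_root_eq_some {n : ℕ} (hn : 0 < n + 1) (A : List OTree) (X : Multiset NTree)
    (hA : NormalList A) (hX : fpow X n = toM A) :
    ∃ Q, root (n + 1) hn A = some Q ∧ toM Q = X := by
  rw [root]
  split_ifs with hp
  · refine ⟨A, rfl, ?_⟩
    have h : toM A = {path (depth A)} := by
      conv_lhs => rw [hp]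
      rfl
    rw [h, eq_of_fpow_eq_path (hX.trans h)]
  · exact exists_rootLoop_eq_some hn A X hA hX [] none X (by simp [toM])
      (by simp [toM]) (.inl ⟨rfl, rfl⟩)
termination_by (sizeOf A, Multiset.card X + 1)

/-- The loop finds every root `X`. In each round the part `R` of `X` that is known is completed
by the smallest tree `y` of maximal depth of the remaining part `Y`; the known trees are at least
as deep as the remaining ones, and `tm` is the smallest known tree. -/
theorem exists_rootLoop_eq_some {n : ℕ} (hn : 0 < n + 1) (A : List OTree) (X : Multiset NTree)
    (hA : NormalList A) (hX : fpow X n = toM A) (R : List OTree) (tm : Option OTree)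
    (Y : Multiset NTree) (hR : X = toM R + Y)
    (hdeep : ∀ r ∈ toM R, ∀ y ∈ Y, y.depth ≤ r.depth)
    (htm : R = [] ∧ tm = none ∨ ∃ m : NTree, tm = some m.val ∧ m ∈ toM R ∧ ∀ r ∈ toM R, m ≤ r) :
    ∃ Q, rootLoop (n + 1) hn A R tm = some Q ∧ toM Q = X := by
  rcases Multiset.empty_or_exists_mem Y with rfl | hY
  · have h : toM (A.diff (pow R (n + 1))) = 0 := by
      rw [toM_diff hA (normalList_pow _ _), toM_pow, ← hX, hR, add_zero, tsub_self]
    refine ⟨R, ?_, by rw [hR, add_zero]⟩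
    rw [rootLoop_eq, toM_eq_zero_iff.mp h]
    rfl
  obtain ⟨y, hy, hy_max, hy_min⟩ := exists_min_deepest (Y := Y) (by
    rintro rfl; exact Multiset.notMem_zero _ hY.choose_spec)
  -- The smallest deepest tree of the rest of `A` is `m ^ n * y`, where `m` is the smallest of `y`
  -- and the known trees.
  have hstep : ∀ m : NTree, m ∈ toM R + Y → (∀ r ∈ toM R, m ≤ r) → m ≤ y →
      y.depth ≤ m.depth → minDeep (depth (A.diff (pow R (n + 1)))) (A.diff (pow R (n + 1))) =
        some (tpow m n * y).val ∧ tpow m n * y ∈ toM A := by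
    intro m hm hmR hmy hdm
    obtain ⟨G, hG, hmem, hall⟩ := exists_fpow_add_eq (D := y.depth) hm hy
      (fun z hz hdz => by
        rcases Multiset.mem_add.mp hz with hz | hz
        · exact hmR z hz
        · exact hmy.trans (hy_min z hz hdz)) hy_min hdm n
    have hF : toM (A.diff (pow R (n + 1))) = G := by
      rw [toM_diff hA (normalList_pow _ _), toM_pow, ← hX, hR, hG, add_tsub_cancel_left]
    have hdp : (tpow m n * y).depth = y.depth := by rw [depth_mul, depth_tpow]; omega
    refine ⟨minDeep_depth_eq_some (hA.diff _) (hF ▸ hmem) ?_ ?_, ?_⟩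
    · rw [hF, hdp]
      intro t ht
      obtain ⟨z, hz, hz'⟩ := (hall t ht).1
      exact hz'.trans (hy_max z hz)
    · rw [hF, hdp]
      exact fun t ht => (hall t ht).2
    · rw [← hX, hR, hG]
      exact Multiset.mem_add.mpr (.inr hmem)
  have hXe : X = (y ::ₘ toM R) + Y.erase y := by
    rw [Multiset.cons_add, ← Multiset.add_cons, Multiset.cons_erase hy, hR]
  have hcard : Multiset.card (Y.erase y) < Multiset.card Y := Multiset.card_erase_lt_of_mem hy
  have hcons : toM (y.val :: R) = y ::ₘ toM R := by
    rw [toM, List.map_cons, nf_val]; rfl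
  have hsub : List.Subperm (pow (y.val :: R) (n + 1)) A := by
    rw [subperm_iff (normalList_pow _ _) hA, toM_pow, ← hX]
    refine fpow_mono ?_ n
    rw [hXe, hcons]
    exact Multiset.le_add_right _ _
  have hdeep' : ∀ r ∈ toM (y.val :: R), ∀ z ∈ Y.erase y, z.depth ≤ r.depth := by
    rw [hcons]
    intro r hr z hz
    rcases Multiset.mem_cons.mp hr with rfl | hr
    · exact hy_max z (Multiset.mem_of_mem_erase hz)
    · exact hdeep r hr z (Multiset.mem_of_mem_erase hz)
  -- A round in which `y` is the smallest of `y` and the known trees.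
  have hroot : (∀ r ∈ toM R, y ≤ r) →
      (tm.all fun m => decide ((tpow y n * y).val.code < (m.pow (n + 1)).code)) = true →
      ∃ Q, rootLoop (n + 1) hn A R tm = some Q ∧ toM Q = X := by
    intro hmin hall
    obtain ⟨hs, hmem⟩ := hstep y (Multiset.mem_add.mpr (.inr hy)) hmin le_rfl le_rfl
    have hlt : sizeOf (tpow y n * y).val.children < sizeOf A :=
      sizeOf_children_lt (hA.val_mem.mpr hmem)
    obtain ⟨q, hq, hq'⟩ := exists_root_eq_some hn (tpow y n * y).val.children y.children
      (normalList_children _) (children_tpow_succ y n).symm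
    have hnf : (OTree.node q).normalize = y.val := by
      change (nf (.node q)).val = _
      rw [nf_node, hq', node_children]
    obtain ⟨Q, hQ, hQ'⟩ := exists_rootLoop_eq_some hn A X hA hX (y.val :: R) (some y.val)
      (Y.erase y) (by rw [hcons, hXe]) hdeep' (.inr ⟨y, rfl, by rw [hcons]; simp, by
        rw [hcons]
        intro r hr
        rcases Multiset.mem_cons.mp hr with rfl | hr
        · exact le_rfl
        · exact hmin r hr⟩)
    refine ⟨Q, ?_, hQ'⟩
    rw [rootLoop_eq, hs]
    simp only [hall, if_true, hq, Option.bind_some, hnf, if_pos hsub, hQ]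
  rcases htm with ⟨rfl, rfl⟩ | ⟨m, rfl, hm, hmin⟩
  · exact hroot (by simp [toM]) rfl
  · rcases le_or_gt m y with hmy | hym
    · obtain ⟨hs, hmem⟩ := hstep m (Multiset.mem_add.mpr (.inl hm)) hmin hmy (hdeep m hm y hy)
      have hnlt : ¬ (tpow m n * y).val.code < (m.val.pow (n + 1)).code := by
        rw [← val_tpow]
        exact not_lt.mpr (mul_le_mul_of_le le_rfl hmy : tpow m n * m ≤ tpow m n * y)
      have hdiv := exists_divide_eq_some (tpow m n) y
        (by rw [depth_tpow]; exact hdeep m hm y hy)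
      rw [val_tpow] at hdiv
      obtain ⟨Q, hQ, hQ'⟩ := exists_rootLoop_eq_some hn A X hA hX (y.val :: R) (some m.val)
        (Y.erase y) (by rw [hcons, hXe]) hdeep'
        (.inr ⟨m, rfl, by rw [hcons]; exact Multiset.mem_cons_of_mem hm, by
          rw [hcons]
          intro r hr
          rcases Multiset.mem_cons.mp hr with rfl | hr
          · exact hmy
          · exact hmin r hr⟩)
      refine ⟨Q, ?_, hQ'⟩
      rw [rootLoop_eq, hs]
      simp only [Option.all_some, decide_eq_true_eq, hnlt, if_false, Option.bind_some,
        Nat.add_sub_cancel, hdiv, if_pos hsub, hQ]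
    · refine hroot (fun r hr => hym.le.trans (hmin r hr)) ?_
      rw [Option.all_some, ← val_tpow]
      exact decide_eq_true (tpow_lt_tpow hym (hdeep m hm y hy) n)
termination_by (sizeOf A, Multiset.card Y)

end

end ForestData

/-! ### From graphs to multisets of trees -/

namespace Multiset

theorem exists_list_map_eq {α β : Type*} {f : α → β} {m : Multiset α} {l : List β}
    (h : m.map f = l) : ∃ l' : List α, (l' : Multiset α) = m ∧ l'.map f = l := by
  classical
  induction l generalizing m with
  | nil => exact ⟨[], by simpa [eq_comm] using h, rfl⟩
  | cons b l ih =>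
    rw [← cons_coe, ← map_eq_cons] at h
    obtain ⟨a, ha, hab, h⟩ := h
    obtain ⟨l', hl', hl⟩ := ih h
    exact ⟨a :: l', by rw [← cons_coe, hl', cons_erase ha], by rw [List.map_cons, hab, hl]⟩

end Multiset

theorem HasDepth.eq {V : Type} {E : V → V → Prop} (hE : ∀ v u u', E v u → E v u' → u = u')
    {m n : ℕ} {v : V} (hm : HasDepth E m v) (hn : HasDepth E n v) : m = n := by
  induction m generalizing n v with
  | zero => cases n with
    | zero => rfl
    | succ n => obtain ⟨u, hu, -⟩ := hn; exact absurd hu (hm u)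
  | succ m ih =>
    obtain ⟨u, hu, hu'⟩ := hm
    cases n with
    | zero => exact absurd hu (hn u)
    | succ n =>
      obtain ⟨w, hw, hw'⟩ := hn
      obtain rfl := hE _ _ _ hu hw
      rw [ih hu' hw']

namespace FinForest

open NTree

theorem wellFounded_E (A : FinForest) : WellFounded A.E := by
  have := A.finite
  have h : ∀ v w, Relation.TransGen A.E v w → ∀ n, HasDepth A.E n w →
      ∃ m, n < m ∧ HasDepth A.E m v := by
    intro v w hvw n hn
    induction hvw using Relation.TransGen.head_induction_on with
    | single h => exact ⟨n + 1, by omega, _, h, hn⟩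
    | head h _ ih =>
      obtain ⟨m, hm, hm'⟩ := ih
      exact ⟨m + 1, by omega, _, h, hm'⟩
  have hirr : Std.Irrefl (Relation.TransGen A.E) := ⟨fun v hv => by
    obtain ⟨n, hn⟩ := A.rooted v
    obtain ⟨m, hm, hm'⟩ := h v v hv n hn
    exact hm.ne (hn.eq A.unique hm')⟩
  exact Subrelation.wf Relation.TransGen.single (Finite.wellFounded_of_trans_of_irrefl _)

/-- The predecessors of a vertex. -/
noncomputable def preds (A : FinForest) (v : A.V) : Finset A.V :=
  have := A.finite
  (Set.toFinite {w | A.E w v}).toFinset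

theorem mem_preds {A : FinForest} {v w : A.V} : w ∈ A.preds v ↔ A.E w v := by simp [preds]

/-- The roots of a forest. -/
noncomputable def roots (A : FinForest) : Finset A.V :=
  have := A.finite
  (Set.toFinite {v | ∀ u, ¬ A.E v u}).toFinset

theorem mem_roots {A : FinForest} {v : A.V} : v ∈ A.roots ↔ ∀ u, ¬ A.E v u := by simp [roots]

/-- The isomorphism class of the tree rooted in a vertex. -/
noncomputable def treeAt (A : FinForest) : A.V → NTree :=
  A.wellFounded_E.fix fun v ih => node ((A.preds v).attach.val.map fun w =>
    ih w.1 (mem_preds.mp w.2))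

theorem treeAt_eq (A : FinForest) (v : A.V) :
    A.treeAt v = node ((A.preds v).val.map A.treeAt) := by
  rw [treeAt, WellFounded.fix_eq]
  exact congrArg node (Multiset.attach_map_val' (A.preds v).val A.treeAt)

theorem children_treeAt (A : FinForest) (v : A.V) :
    (A.treeAt v).children = (A.preds v).val.map A.treeAt := by
  rw [treeAt_eq, children_node]

/-- The multiset of the isomorphism classes of the trees of a forest. -/
noncomputable def trees (A : FinForest) : Multiset NTree := A.roots.val.map A.treeAt

theorem coe_eq_val_iff {α : Type*} {l : List α} {s : Finset α} :
    (l : Multiset α) = s.val ↔ l.Nodup ∧ ∀ a, a ∈ l ↔ a ∈ s := by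
  constructor
  · intro h
    exact ⟨Multiset.coe_nodup.mp (h ▸ s.nodup), fun a => by rw [← Finset.mem_val, ← h]; rfl⟩
  · rintro ⟨h1, h2⟩
    exact (Multiset.Nodup.ext (Multiset.coe_nodup.mpr h1) s.nodup).mpr fun a => h2 a

/-- A list of trees encodes the vertices of a set, in some order, if and only if the multisets of
isomorphism classes are the same. -/
theorem toM_eq_map_iff {A : FinForest} {F : List OTree} {s : Finset A.V}
    (ih : ∀ t ∈ F, ∀ v, Encodes A v t ↔ nf t = A.treeAt v) :
    (∃ vs : List A.V, vs.Nodup ∧ (∀ v, v ∈ vs ↔ v ∈ s) ∧ List.Forall₂ (Encodes A) vs F) ↔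
      toM F = s.val.map A.treeAt := by
  have key : ∀ vs : List A.V, List.Forall₂ (Encodes A) vs F ↔ vs.map A.treeAt = F.map nf := by
    intro vs
    rw [← List.forall₂_eq_eq_eq, List.forall₂_map_left_iff, List.forall₂_map_right_iff,
      List.forall₂_iff_get, List.forall₂_iff_get]
    refine and_congr_right fun _ => forall₃_congr fun i _ hi => ?_
    rw [ih _ (List.get_mem _ _), eq_comm]
  simp only [key]
  constructor
  · rintro ⟨vs, h1, h2, h3⟩
    rw [← coe_eq_val_iff.mpr ⟨h1, h2⟩, Multiset.map_coe, h3, toM]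
  · intro h
    obtain ⟨vs, h1, h2⟩ := Multiset.exists_list_map_eq h.symm
    obtain ⟨h3, h4⟩ := coe_eq_val_iff.mp h1
    exact ⟨vs, h3, h4, h2⟩

/-- The data that encode the tree rooted in a vertex are those of its isomorphism class. -/
theorem encodes_iff {A : FinForest} {v : A.V} {t : OTree} :
    Encodes A v t ↔ nf t = A.treeAt v := by
  induction t using OTree.induction generalizing v with
  | h ts ih =>
    have h1 : Encodes A v (.node ts) ↔ ∃ vs : List A.V, vs.Nodup ∧
        (∀ w, w ∈ vs ↔ w ∈ A.preds v) ∧ List.Forall₂ (Encodes A) vs ts := by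
      simp only [mem_preds]
      exact ⟨fun | .node _ ws _ h1 h2 h3 => ⟨ws, h1, h2, h3⟩,
        fun ⟨ws, h1, h2, h3⟩ => .node v ws ts h1 h2 h3⟩
    rw [h1, toM_eq_map_iff fun t ht v => ih t ht, nf_node, treeAt_eq]
    exact ⟨fun h => by rw [h], fun h => by simpa using congrArg children h⟩

/-- A list of trees represents a forest if and only if the isomorphism classes of its trees are
those of the trees of the forest. -/
theorem represents_iff {A : FinForest} {F : List OTree} : Represents F A ↔ toM F = A.trees := by
  rw [trees, ← toM_eq_map_iff fun _ _ _ => encodes_iff]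
  simp only [mem_roots]
  rfl

/-- An injective map between forests that identifies the predecessors of the vertices preserves
the trees rooted in the vertices. -/
theorem treeAt_map {A B : FinForest} {f : A.V → B.V} (hf : Function.Injective f)
    (h : ∀ v w, B.E w (f v) ↔ ∃ w', A.E w' v ∧ f w' = w) (v : A.V) :
    B.treeAt (f v) = A.treeAt v := by
  induction v using A.wellFounded_E.induction with
  | _ v ih =>
    have h1 : B.preds (f v) = (A.preds v).map ⟨f, hf⟩ := by
      ext w; simp [mem_preds, h]
    rw [treeAt_eq, treeAt_eq, h1, Finset.map_val, Multiset.map_map]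
    exact congrArg node (Multiset.map_congr rfl fun w hw => ih w (mem_preds.mp hw))

theorem Iso.trees_eq {A B : FinForest} (h : A.Iso B) : A.trees = B.trees := by
  obtain ⟨e⟩ := h
  have h1 : B.roots = A.roots.map e.toEquiv.toEmbedding := by
    ext w
    obtain ⟨v, rfl⟩ := e.surjective w
    rw [Finset.mem_map_equiv, show e.toEquiv.symm (e v) = v from e.toEquiv.symm_apply_apply v,
      mem_roots, mem_roots]
    refine ⟨fun h u hu => h (e u) (e.map_rel_iff.mpr hu), fun h u hu => ?_⟩
    obtain ⟨u, rfl⟩ := e.surjective u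
    exact h u (e.map_rel_iff.mp hu)
  rw [trees, trees, h1, Finset.map_val, Multiset.map_map]
  refine Multiset.map_congr rfl fun v _ => (treeAt_map e.injective (fun v w => ?_) v).symm
  constructor
  · intro h
    exact ⟨e.symm w, by simpa using e.symm.map_rel_iff.mpr h, by simp⟩
  · rintro ⟨w', h, rfl⟩
    exact e.map_rel_iff.mpr h

/-! ### Isomorphisms from equal multisets of trees -/

/-- Two functions with the same multiset of values are matched by a bijection of their domains. -/
theorem exists_equiv_of_map_eq {α β γ : Type*} {s : Finset α} {t : Finset β} {f : α → γ}
    {g : β → γ} (h : s.val.map f = t.val.map g) :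
    ∃ e : {a // a ∈ s} ≃ {b // b ∈ t}, ∀ a, g (e a).1 = f a.1 := by
  obtain ⟨l, hl, hl'⟩ : ∃ l : List β, (l : Multiset β) = t.val ∧ l.map g = s.toList.map f :=
    Multiset.exists_list_map_eq (by rw [← h, ← Finset.coe_toList, Multiset.map_coe])
  obtain ⟨hln, hlm⟩ := coe_eq_val_iff.mp hl
  have hlen : s.toList.length = l.length := by simpa using (congrArg List.length hl').symm
  classical
  let e₁ : Fin s.toList.length ≃ {a // a ∈ s} :=
    (s.nodup_toList.getEquiv s.toList).trans (Equiv.subtypeEquivRight fun a => Finset.mem_toList)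
  let e₂ : Fin l.length ≃ {b // b ∈ t} :=
    (hln.getEquiv l).trans (Equiv.subtypeEquivRight hlm)
  refine ⟨e₁.symm.trans ((finCongr hlen).trans e₂), fun a => ?_⟩
  obtain ⟨i, rfl⟩ := e₁.surjective a
  have h1 : (l.map g)[i.1]'(by rw [List.length_map, ← hlen]; exact i.2) =
      (s.toList.map f)[i.1]'(by rw [List.length_map]; exact i.2) := by
    simp only [hl']
  simpa [e₁, e₂] using h1

/-- The vertices of depth `n`. -/
def Level (A : FinForest) (n : ℕ) : Type := {v : A.V // HasDepth A.E n v}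

/-- The vertices of depth `n + 1` are the predecessors of the vertices of depth `n`. -/
noncomputable def levelSuccEquiv (A : FinForest) (n : ℕ) :
    A.Level (n + 1) ≃ Σ u : A.Level n, {w // w ∈ A.preds u.1} where
  toFun v := ⟨⟨v.2.choose, v.2.choose_spec.2⟩, ⟨v.1, mem_preds.mpr v.2.choose_spec.1⟩⟩
  invFun p := ⟨p.2.1, p.1.1, mem_preds.mp p.2.2, p.1.2⟩
  left_inv v := rfl
  right_inv p := by
    obtain ⟨⟨u, hu⟩, ⟨w, hw⟩⟩ := p
    have h : ∃ u, A.E w u ∧ HasDepth A.E n u := ⟨u, mem_preds.mp hw, hu⟩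
    have h1 : h.choose = u := A.unique _ _ _ h.choose_spec.1 (mem_preds.mp hw)
    have h2 : ∀ (u' : A.V) (hu' : HasDepth A.E n u') (hw' : w ∈ A.preds u'), u' = u →
        (⟨⟨u', hu'⟩, ⟨w, hw'⟩⟩ : Σ u : A.Level n, {w // w ∈ A.preds u.1}) =
          ⟨⟨u, hu⟩, ⟨w, hw⟩⟩ := by
      rintro u' hu' hw' rfl; rfl
    exact h2 _ _ _ h1

theorem E_levelSuccEquiv (A : FinForest) (n : ℕ) (v : A.Level (n + 1)) :
    A.E v.1 (A.levelSuccEquiv n v).1.1 := v.2.choose_spec.1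

/-- A bijection between the vertices of depth `n` of two forests that preserves the trees rooted
in the vertices. -/
def LevelEquiv (A B : FinForest) (n : ℕ) : Type :=
  {e : A.Level n ≃ B.Level n // ∀ v, B.treeAt (e v).1 = A.treeAt v.1}

/-- Vertices with isomorphic trees have predecessors with isomorphic trees, which can be matched. -/
theorem exists_levelEquiv_succ {A B : FinForest} {n : ℕ} (e : LevelEquiv A B n) :
    ∃ e' : LevelEquiv A B (n + 1), ∀ v u, A.E v.1 u.1 → B.E (e'.1 v).1 (e.1 u).1 := by
  have h : ∀ u : A.Level n, ∃ σ : {w // w ∈ A.preds u.1} ≃ {w // w ∈ B.preds (e.1 u).1},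
      ∀ w, B.treeAt (σ w).1 = A.treeAt w.1 := fun u =>
    exists_equiv_of_map_eq (by rw [← children_treeAt, ← children_treeAt, e.2])
  choose σ hσ using h
  refine ⟨⟨(A.levelSuccEquiv n).trans ((Equiv.sigmaCongr e.1 σ).trans (B.levelSuccEquiv n).symm),
    fun v => ?_⟩, fun v u hvu => ?_⟩
  · exact hσ _ _
  · have h1 := A.unique _ _ _ hvu (A.E_levelSuccEquiv n v)
    have h2 : u = (A.levelSuccEquiv n v).1 := Subtype.ext h1
    subst h2
    exact mem_preds.mp (σ _ _).2

theorem exists_levelEquiv_zero {A B : FinForest} (h : A.trees = B.trees) :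
    Nonempty (LevelEquiv A B 0) := by
  obtain ⟨e, he⟩ := exists_equiv_of_map_eq h
  exact ⟨⟨(Equiv.subtypeEquivRight fun _ => mem_roots.symm).trans
    (e.trans (Equiv.subtypeEquivRight fun _ => mem_roots)), fun v => he _⟩⟩

/-- The depth of a vertex. -/
noncomputable def depthAt (A : FinForest) (v : A.V) : ℕ := (A.rooted v).choose

theorem hasDepth_depthAt (A : FinForest) (v : A.V) : HasDepth A.E (A.depthAt v) v :=
  (A.rooted v).choose_spec

/-- The vertices are distributed among the levels. -/
noncomputable def sigmaLevelEquiv (A : FinForest) : A.V ≃ Σ n, A.Level n where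
  toFun v := ⟨A.depthAt v, v, A.hasDepth_depthAt v⟩
  invFun p := p.2.1
  left_inv v := rfl
  right_inv p := by
    obtain ⟨n, v, hv⟩ := p
    obtain rfl := hv.eq A.unique (A.hasDepth_depthAt v)
    rfl

/-- The bijections between the levels are built one after the other, each compatible with the
previous one, and glued together. -/
theorem iso_of_trees_eq {A B : FinForest} (h : A.trees = B.trees) : A.Iso B := by
  obtain ⟨e₀⟩ := exists_levelEquiv_zero h
  choose next hnext using @exists_levelEquiv_succ A B
  let e : ∀ n, LevelEquiv A B n := fun n => Nat.rec e₀ (fun _ e => next e) n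
  have he : ∀ n v u, A.E v.1 u.1 → B.E ((e (n + 1)).1 v).1 ((e n).1 u).1 := fun n => hnext (e n)
  let φ : A.V ≃ B.V := A.sigmaLevelEquiv.trans
    ((Equiv.sigmaCongrRight fun n => (e n).1).trans B.sigmaLevelEquiv.symm)
  have hφ : ∀ n v (hv : HasDepth A.E n v), φ v = ((e n).1 ⟨v, hv⟩).1 := by
    intro n v hv
    obtain rfl := hv.eq A.unique (A.hasDepth_depthAt v)
    rfl
  have hE : ∀ v u, A.E v u → B.E (φ v) (φ u) := by
    intro v u hvu
    have hu := A.hasDepth_depthAt u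
    rw [hφ _ u hu, hφ (A.depthAt u + 1) v ⟨u, hvu, hu⟩]
    exact he (A.depthAt u) ⟨v, u, hvu, hu⟩ ⟨u, hu⟩ hvu
  refine ⟨⟨φ, fun {v u} => ⟨fun h => ?_, hE v u⟩⟩⟩
  -- The vertex `φ v` has a parent, hence so does `v`, and `φ` maps parents to parents.
  have hv := A.hasDepth_depthAt v
  cases hn : A.depthAt v with
  | zero =>
    rw [hn] at hv
    have h1 := ((e 0).1 ⟨v, hv⟩).2
    exact absurd h (hφ 0 v hv ▸ h1 (φ u))
  | succ n =>
    rw [hn] at hv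
    obtain ⟨w, hw, -⟩ := hv
    have h1 := B.unique _ _ _ h (hE v w hw)
    rwa [φ.injective h1]

/-! ### Operations on forests -/

/-- The vertex of depth `i` of a path. -/
def pathVertex (d i : ℕ) (h : i ≤ d) : (path d).V := ⟨i, by omega⟩

theorem exists_pathVertex {d : ℕ} (w : (path d).V) : ∃ i h, w = pathVertex d i h :=
  ⟨Fin.val w, Nat.le_of_lt_succ (Fin.isLt w), rfl⟩

theorem E_pathVertex {d i j : ℕ} {hi : i ≤ d} {hj : j ≤ d} :
    (path d).E (pathVertex d i hi) (pathVertex d j hj) ↔ i = j + 1 := Iff.rfl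

theorem pathVertex_inj {d i j : ℕ} {hi : i ≤ d} {hj : j ≤ d} :
    pathVertex d i hi = pathVertex d j hj ↔ i = j := Fin.mk.injEq .. ▸ Iff.rfl

theorem trees_path (d : ℕ) : (path d).trees = {NTree.path d} := by
  have h : ∀ (i : ℕ) (hi : i ≤ d), (path d).treeAt (pathVertex d i hi) = NTree.path (d - i) := by
    intro i hi
    induction hj : d - i generalizing i with
    | zero =>
      apply children_injective
      have : (path d).preds (pathVertex d i hi) = ∅ := by
        ext w
        obtain ⟨j, hj', rfl⟩ := exists_pathVertex w
        simp only [mem_preds, E_pathVertex, Finset.notMem_empty, iff_false]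
        omega
      rw [children_treeAt, this, children_path_zero]
      rfl
    | succ j ih =>
      apply children_injective
      have : (path d).preds (pathVertex d i hi) = {pathVertex d (i + 1) (by omega)} := by
        ext w
        obtain ⟨j, hj', rfl⟩ := exists_pathVertex w
        simp only [mem_preds, E_pathVertex, Finset.mem_singleton, pathVertex_inj]
      rw [children_treeAt, this, children_path_succ, ← ih (i + 1) (by omega) (by omega)]
      rfl
  have h1 : (path d).roots = {pathVertex d 0 (by omega)} := by
    ext w
    obtain ⟨i, hi, rfl⟩ := exists_pathVertex w
    simp only [mem_roots, Finset.mem_singleton, pathVertex_inj]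
    constructor
    · intro hw
      by_contra h0
      exact hw (pathVertex d (i - 1) (by omega)) (E_pathVertex.mpr (by omega))
    · rintro rfl u
      obtain ⟨j, hj, rfl⟩ := exists_pathVertex u
      rw [E_pathVertex]
      omega
  rw [trees, h1, Finset.singleton_val, Multiset.map_singleton, h 0 (by omega), Nat.sub_zero]

/-- The two components of a vertex of a product. -/
def toPair {A B : FinForest} (p : (A.prod B).V) : A.V × B.V := p.1

theorem toPair_injective {A B : FinForest} : Function.Injective (toPair (A := A) (B := B)) :=
  Subtype.val_injective

theorem exists_toPair_eq {A B : FinForest} {q : A.V × B.V} {n : ℕ} (h1 : HasDepth A.E n q.1)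
    (h2 : HasDepth B.E n q.2) : ∃ p : (A.prod B).V, toPair p = q := ⟨⟨q, n, h1, h2⟩, rfl⟩

theorem exists_hasDepth_toPair {A B : FinForest} (p : (A.prod B).V) :
    ∃ n, HasDepth A.E n (toPair p).1 ∧ HasDepth B.E n (toPair p).2 := p.2

theorem E_prod {A B : FinForest} {p q : (A.prod B).V} : (A.prod B).E p q ↔
    A.E (toPair p).1 (toPair q).1 ∧ B.E (toPair p).2 (toPair q).2 := Iff.rfl

theorem treeAt_prod {A B : FinForest} (p : (A.prod B).V) :
    (A.prod B).treeAt p = A.treeAt (toPair p).1 * B.treeAt (toPair p).2 := by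
  induction p using (A.prod B).wellFounded_E.induction with
  | _ p ih =>
    apply children_injective
    have h1 : ((A.prod B).preds p).val.map toPair =
        (A.preds (toPair p).1).val ×ˢ (B.preds (toPair p).2).val := by
      refine (Multiset.Nodup.ext (((A.prod B).preds p).nodup.map toPair_injective)
        ((A.preds _).nodup.product (B.preds _).nodup)).mpr fun q => ?_
      simp only [Multiset.mem_map, Finset.mem_val, mem_preds, Multiset.mem_product]
      constructor
      · rintro ⟨q, hq, rfl⟩
        exact hq
      · rintro ⟨hq1, hq2⟩
        obtain ⟨n, hv, hw⟩ := exists_hasDepth_toPair p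
        obtain ⟨r, rfl⟩ := exists_toPair_eq (n := n + 1) ⟨_, hq1, hv⟩ ⟨_, hq2, hw⟩
        exact ⟨r, ⟨hq1, hq2⟩, rfl⟩
    rw [children_treeAt, children_mul, children_treeAt, children_treeAt, fmul, map_product_map,
      ← h1, Multiset.map_map]
    exact Multiset.map_congr rfl fun q hq => ih q (mem_preds.mp hq)

theorem trees_prod (A B : FinForest) : (A.prod B).trees = fmul A.trees B.trees := by
  have h1 : ((A.prod B).roots).val.map toPair = A.roots.val ×ˢ B.roots.val := by
    refine (Multiset.Nodup.ext ((A.prod B).roots.nodup.map toPair_injective)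
      (A.roots.nodup.product B.roots.nodup)).mpr fun q => ?_
    simp only [Multiset.mem_map, Finset.mem_val, mem_roots, Multiset.mem_product]
    constructor
    · rintro ⟨p, hp, rfl⟩
      obtain ⟨n, hv, hw⟩ := exists_hasDepth_toPair p
      cases n with
      | zero => exact ⟨hv, hw⟩
      | succ n =>
        obtain ⟨v', h1, h1'⟩ := hv
        obtain ⟨w', h2, h2'⟩ := hw
        obtain ⟨r, hr⟩ := exists_toPair_eq (q := (v', w')) h1' h2'
        exact absurd (E_prod.mpr (by rw [hr]; exact ⟨h1, h2⟩)) (hp r)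
    · rintro ⟨hq1, hq2⟩
      obtain ⟨r, rfl⟩ := exists_toPair_eq (n := 0) hq1 hq2
      exact ⟨r, fun u hu => hq1 _ hu.1, rfl⟩
  rw [trees, trees, trees, fmul, map_product_map, ← h1, Multiset.map_map]
  exact Multiset.map_congr rfl fun q _ => treeAt_prod q

/-- A longest branch of the tree rooted in a vertex comes from vertices of the forest. -/
theorem exists_hasDepth_add_depth {A : FinForest} {v : A.V} {m : ℕ} (hv : HasDepth A.E m v) :
    ∃ w, HasDepth A.E (m + (A.treeAt v).depth) w := by
  induction v using A.wellFounded_E.induction generalizing m with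
  | _ v ih =>
    by_cases h : (A.treeAt v).depth = 0
    · exact ⟨v, by rwa [h]⟩
    · obtain ⟨c, hc, hc'⟩ := exists_mem_children_depth h
      rw [children_treeAt] at hc
      obtain ⟨w, hw, rfl⟩ := Multiset.mem_map.mp hc
      have hw := mem_preds.mp hw
      obtain ⟨x, hx⟩ := ih w hw (m := m + 1) ⟨v, hw, hv⟩
      exact ⟨x, by rwa [← hc', Nat.add_comm _ 1, ← Nat.add_assoc]⟩

theorem depth_le_of_mem_trees {A : FinForest} {t : NTree} (ht : t ∈ A.trees) :
    t.depth ≤ A.depth := by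
  obtain ⟨v, hv, rfl⟩ := Multiset.mem_map.mp ht
  obtain ⟨w, hw⟩ := exists_hasDepth_add_depth (m := 0) (mem_roots.mp hv)
  have := A.finite
  refine le_csSup (Set.Finite.bddAbove ?_) ⟨w, by simpa using hw⟩
  refine (Set.finite_range A.depthAt).subset ?_
  rintro n ⟨v, hv⟩
  exact ⟨v, (A.hasDepth_depthAt v).eq A.unique hv⟩

theorem trees_pow_succ (A : FinForest) (n : ℕ) : (A.pow (n + 1)).trees = fpow A.trees n := by
  induction n with
  | zero =>
    rw [pow, pow, trees_prod, trees_path, singleton_fmul, fpow, Multiset.map_congr rfl (g := id),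
      Multiset.map_id]
    exact fun t ht => path_mul_of_depth_le (depth_le_of_mem_trees ht)
  | succ n ih => rw [pow, trees_prod, ih, fpow]

/-! ### Every multiset of trees is the multiset of the trees of a forest -/

/-- The empty forest. -/
def empty : FinForest where
  V := Empty
  E _ _ := False
  finite := inferInstance
  unique v := v.elim
  rooted v := v.elim

/-- The disjoint union of forests. -/
def sum (A B : FinForest) : FinForest where
  V := A.V ⊕ B.V
  E := Sum.LiftRel A.E B.E
  finite := by
    have := A.finite
    have := B.finite
    infer_instance
  unique := by
    rintro _ _ _ (⟨h⟩ | ⟨h⟩) (⟨h'⟩ | ⟨h'⟩)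
    · rw [A.unique _ _ _ h h']
    · rw [B.unique _ _ _ h h']
  rooted := by
    rintro (v | v)
    · obtain ⟨n, hn⟩ := A.rooted v
      refine ⟨n, ?_⟩
      induction n generalizing v with
      | zero => rintro _ ⟨h⟩; exact hn _ h
      | succ n ih =>
        obtain ⟨u, hu, hu'⟩ := hn
        exact ⟨.inl u, .inl hu, ih u hu'⟩
    · obtain ⟨n, hn⟩ := B.rooted v
      refine ⟨n, ?_⟩
      induction n generalizing v with
      | zero => rintro _ (_ | ⟨h⟩); exact hn _ h
      | succ n ih =>
        obtain ⟨u, hu, hu'⟩ := hn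
        exact ⟨.inr u, .inr hu, ih u hu'⟩

/-- The tree obtained from a forest by joining its roots to a new vertex. -/
def join (A : FinForest) : FinForest where
  V := Option A.V
  E
    | some v, some u => A.E v u
    | some v, none => ∀ u, ¬ A.E v u
    | none, _ => False
  finite := by
    have := A.finite
    infer_instance
  unique := by
    rintro (_ | v) (_ | u) (_ | u') h h'
    all_goals first
      | exact h.elim
      | rfl
      | exact absurd h' (h _)
      | exact absurd h (h' _)
      | rw [A.unique _ _ _ h h']
  rooted := by
    rintro (_ | v)
    · exact ⟨0, fun u h => h⟩
    · obtain ⟨n, hn⟩ := A.rooted v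
      refine ⟨n + 1, ?_⟩
      induction n generalizing v with
      | zero => exact ⟨none, hn, fun u h => h⟩
      | succ n ih =>
        obtain ⟨u, hu, hu'⟩ := hn
        exact ⟨some u, hu, ih u hu'⟩

theorem trees_empty : empty.trees = 0 := by
  have : empty.roots = ∅ := by ext v; exact v.elim
  rw [trees, this]
  rfl

/-- The inclusion of the first forest in a disjoint union. -/
def inl {A B : FinForest} (v : A.V) : (A.sum B).V := Sum.inl v

/-- The inclusion of the second forest in a disjoint union. -/
def inr {A B : FinForest} (v : B.V) : (A.sum B).V := Sum.inr v

theorem inl_injective {A B : FinForest} : Function.Injective (inl (A := A) (B := B)) :=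
  Sum.inl_injective

theorem inr_injective {A B : FinForest} : Function.Injective (inr (A := A) (B := B)) :=
  Sum.inr_injective

theorem trees_sum (A B : FinForest) : (A.sum B).trees = A.trees + B.trees := by
  have h1 : ∀ v, (A.sum B).treeAt (inl v) = A.treeAt v :=
    treeAt_map inl_injective fun v w => by
      constructor
      · rintro ⟨h⟩; exact ⟨_, h, rfl⟩
      · rintro ⟨w, h, rfl⟩; exact .inl h
  have h2 : ∀ v, (A.sum B).treeAt (inr v) = B.treeAt v :=
    treeAt_map inr_injective fun v w => by
      constructor
      · rintro (_ | ⟨h⟩); exact ⟨_, h, rfl⟩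
      · rintro ⟨w, h, rfl⟩; exact .inr h
  have h3 : (A.sum B).roots.val = A.roots.val.map inl + B.roots.val.map inr := by
    refine (Multiset.Nodup.ext (A.sum B).roots.nodup (Multiset.nodup_add.mpr
      ⟨A.roots.nodup.map inl_injective, B.roots.nodup.map inr_injective, ?_⟩)).mpr fun v => ?_
    · refine Multiset.disjoint_left.mpr fun {v} hv hv' => ?_
      obtain ⟨a, -, rfl⟩ := Multiset.mem_map.mp hv
      obtain ⟨b, -, h⟩ := Multiset.mem_map.mp hv'
      cases h
    · simp only [Multiset.mem_add, Multiset.mem_map, Finset.mem_val, mem_roots]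
      constructor
      · intro h
        rcases v with v | v
        · exact .inl ⟨v, fun u hu => h (inl u) (.inl hu), rfl⟩
        · exact .inr ⟨v, fun u hu => h (inr u) (.inr hu), rfl⟩
      · rintro (⟨v, h, rfl⟩ | ⟨v, h, rfl⟩)
        · rintro _ ⟨hu⟩; exact h _ hu
        · rintro _ (_ | ⟨hu⟩); exact h _ hu
  rw [trees, h3, Multiset.map_add, Multiset.map_map, Multiset.map_map]
  exact congrArg₂ _ (Multiset.map_congr rfl fun v _ => h1 v)
    (Multiset.map_congr rfl fun v _ => h2 v)

/-- The inclusion of a forest in the tree that joins its roots. -/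
def joinSome {A : FinForest} (v : A.V) : A.join.V := some v

/-- The new root. -/
def joinRoot (A : FinForest) : A.join.V := none

theorem joinSome_injective {A : FinForest} : Function.Injective (joinSome (A := A)) :=
  Option.some_injective _

theorem eq_joinRoot_or (A : FinForest) (v : A.join.V) :
    v = joinRoot A ∨ ∃ w, v = joinSome w := by
  rcases v with _ | w
  · exact .inl rfl
  · exact .inr ⟨w, rfl⟩

theorem not_E_joinRoot {A : FinForest} (v : A.join.V) : ¬ A.join.E (joinRoot A) v := fun h => h

theorem trees_join (A : FinForest) : A.join.trees = {node A.trees} := by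
  have h1 : ∀ v, A.join.treeAt (joinSome v) = A.treeAt v :=
    treeAt_map joinSome_injective fun v w => by
      constructor
      · intro h
        rcases A.eq_joinRoot_or w with rfl | ⟨w, rfl⟩
        · exact absurd h (not_E_joinRoot _)
        · exact ⟨w, h, rfl⟩
      · rintro ⟨w, h, rfl⟩; exact h
  have h2 : A.join.roots = {joinRoot A} := by
    ext v
    rw [mem_roots, Finset.mem_singleton]
    constructor
    · intro h
      rcases A.eq_joinRoot_or v with rfl | ⟨v, rfl⟩
      · rfl
      · exact absurd (fun u hu => h (joinSome u) hu) (h (joinRoot A))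
    · rintro rfl u
      exact not_E_joinRoot u
  have h3 : A.join.preds (joinRoot A) = A.roots.map ⟨joinSome, joinSome_injective⟩ := by
    ext v
    simp only [mem_preds, Finset.mem_map, mem_roots, Function.Embedding.coeFn_mk]
    rcases A.eq_joinRoot_or v with rfl | ⟨v, rfl⟩
    · exact ⟨fun h => absurd h (not_E_joinRoot _), fun ⟨_, _, h⟩ => by cases h⟩
    · exact ⟨fun h => ⟨v, h, rfl⟩, fun ⟨w, hw, h⟩ => joinSome_injective h ▸ hw⟩
  rw [trees, h2, Finset.singleton_val, Multiset.map_singleton, treeAt_eq, h3, Finset.map_val,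
    Multiset.map_map, trees]
  congr 2
  exact Multiset.map_congr rfl fun v _ => h1 v

theorem exists_trees_eq (S : Multiset NTree) : ∃ A : FinForest, A.trees = S := by
  have hsum : ∀ S : Multiset NTree, (∀ t ∈ S, ∃ A : FinForest, A.trees = {t}) →
      ∃ A : FinForest, A.trees = S := by
    intro S hS
    induction S using Multiset.induction with
    | empty => exact ⟨empty, trees_empty⟩
    | cons t S ih =>
      obtain ⟨A, hA⟩ := hS t (Multiset.mem_cons_self t S)
      obtain ⟨B, hB⟩ := ih fun s hs => hS s (Multiset.mem_cons_of_mem hs)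
      exact ⟨A.sum B, by rw [trees_sum, hA, hB, Multiset.singleton_add]⟩
  refine hsum S fun t ht => ?_
  clear ht
  induction t using NTree.induction with
  | h t ih =>
    obtain ⟨A, hA⟩ := hsum t.children ih
    exact ⟨A.join, by rw [trees_join, hA, node_children]⟩

end FinForest

/-! ### Correctness of the procedure -/

theorem mainTheorem4 (k : ℕ) (hk : 0 < k) (A : FinForest) (F : List OTree)
    (hF : Represents F A) :
    (∀ R : List OTree, ForestData.kthRoot k hk F = some R →
      ∃ X : FinForest, Represents R X ∧ (X.pow k).Iso A) ∧
    (∀ X : FinForest, (X.pow k).Iso A →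
      ∃ R : List OTree, ForestData.kthRoot k hk F = some R ∧ Represents R X) := by
  obtain ⟨n, rfl⟩ := Nat.exists_eq_add_one_of_ne_zero hk.ne'
  have hnorm : NTree.NormalList (F.map OTree.normalize) := fun t ht => by
    obtain ⟨s, -, rfl⟩ := List.mem_map.mp ht
    exact s.normalize_normalize
  have hA : NTree.toM (F.map OTree.normalize) = A.trees := by
    rw [NTree.toM_map_normalize, FinForest.represents_iff.mp hF]
  refine ⟨fun R hR => ?_, fun X hX => ?_⟩
  · obtain ⟨X, hX⟩ := FinForest.exists_trees_eq (NTree.toM R)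
    refine ⟨X, FinForest.represents_iff.mpr hX.symm, FinForest.iso_of_trees_eq ?_⟩
    rw [FinForest.trees_pow_succ, hX, ForestData.toM_eq_of_root_eq_some hnorm hR, hA]
  · obtain ⟨R, hR, hR'⟩ := ForestData.exists_root_eq_some hk (F.map OTree.normalize) X.trees hnorm
      (by rw [← FinForest.trees_pow_succ, hX.trees_eq, hA])
    exact ⟨R, hR, FinForest.represents_iff.mpr hR'⟩
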